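/- Let $d\in\{2,3\}$ and let $\mathcal O\subset\mathbb R^d$ be a bounded open set (in particular, any bounded domain with smooth boundary). Put $\mathcal H=L^2(\mathcal O)$ (real-valued functions) and $\mathcal V=H^1_0(\mathcal O)\cap H^2(\mathcal O)$, and write $\|u\|_{H^1_0}=\|\nabla u\|_{L^2(\mathcal O)}$ and $\|u\|_{H^2_0}=\|\Delta u\|_{L^2(\mathcal O)}$ for $u\in\mathcal V$. For real $n\ge 1$ let $$F(u)=\|u\|_{H^2_0}^2\,u+2\|u\|_{H^1_0}^2\,u+\|u\|_{L^{2n}}^{2n}\,u-u^{2n-1},$$ where $u^{2n-1}$ means $|u|^{2n-2}u$, which is the usual power when $n$ is an integer. Then there is a constant $C>0$ depending only on $\mathcal O$ and, for every real $n\ge1$, a constant $C_n>0$ depending only on $\mathcal O$ and $n$, such that $\mathcal V\subset L^{2n}(\mathcal O)$, $F$ maps $\mathcal V$ into $\mathcal H$, $F:\mathcal V\to\mathcal H$ is locally Lipschitz, and $$\|F(u_1)-F(u_2)\|_{\mathcal H}\le \mathcal G\big(\|u_1\|_{\mathcal V},\|u_2\|_{\mathcal V}\big)\,\|u_1-u_2\|_{\mathcal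 V}\qquad\text{for all }u_1,u_2\in\mathcal V,$$ where, for $r,s\ge0$, $$\mathcal G(r,s)=2C\,(r^2+s^2+rs)+C_n\Big[\tfrac{2n-1}{2}\,(r^{2n-1}+s^{2n-1})(r+s)+(r^{2n}+s^{2n})+(1+r^2+s^2)^{1/3}\Big].$$ The estimate holds both for the norm $\|u\|_{\mathcal V}=\big(\|u\|_{L^2}^2+2\|\nabla u\|_{L^2}^2+\|\Delta u\|_{L^2}^2\big)^{1/2}$ and for the full $H^2(\mathcal O)$-norm $\|u\|_{\mathcal V}=\big(\|u\|_{L^2}^2+\sum_i\|\partial_i u\|_{L^2}^2+\sum_{i,j}\|\partial_j\partial_i u\|_{L^2}^2\big)^{1/2}$; local Lipschitz continuity is meant with respect to the latter. -/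

import Mathlib

open MeasureTheory TopologicalSpace
open scoped Distributions

noncomputable section

namespace SwiftHohenberg

variable {d : ℕ}

/-- The real Hilbert space `L²(O)` (Lebesgue measure on the open set `O ⊆ ℝᵈ`). -/
abbrev L2 (O : Opens (EuclideanSpace ℝ (Fin d))) : Type :=
  Lp ℝ 2 (volume.restrict (O : Set (EuclideanSpace ℝ (Fin d))))

/-- The classical `i`-th partial derivative. -/
def partialDeriv (i : Fin d) (φ : EuclideanSpace ℝ (Fin d) → ℝ)
    (x : EuclideanSpace ℝ (Fin d)) : ℝ :=
  fderiv ℝ φ x (EuclideanSpace.single i 1)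

/-- `v ∈ L²(O)` is the weak `i`-th partial derivative of `u ∈ L²(O)` on `O`:
`∫_O u ∂ᵢφ = - ∫_O v φ` for all `φ ∈ C_c^∞(O)`. -/
def IsWeakPartial {O : Opens (EuclideanSpace ℝ (Fin d))} (i : Fin d) (u v : L2 O) : Prop :=
  ∀ φ : 𝓓(O, ℝ),
    ∫ x in (O : Set (EuclideanSpace ℝ (Fin d))), u x * partialDeriv i φ x =
      -∫ x in (O : Set (EuclideanSpace ℝ (Fin d))), v x * φ x

/-- The `L²(O)` Hilbert space of pairs `(u, ∇u)`; its norm is the `H¹` norm. -/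
abbrev Jet1 (O : Opens (EuclideanSpace ℝ (Fin d))) : Type :=
  PiLp 2 (fun _ : Unit ⊕ Fin d => L2 O)

/-- The `L²(O)` Hilbert space of triples `(u, ∇u, D²u)`; its norm is the `H²` norm
`(‖u‖² + ∑ᵢ ‖∂ᵢu‖² + ∑ᵢⱼ ‖∂ⱼ∂ᵢu‖²)^(1/2)`. -/
abbrev Jet2 (O : Opens (EuclideanSpace ℝ (Fin d))) : Type :=
  PiLp 2 (fun _ : (Unit ⊕ Fin d) ⊕ (Fin d × Fin d) => L2 O)

/-- Forget the second derivatives. -/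
def Jet2.toJet1 (O : Opens (EuclideanSpace ℝ (Fin d))) : Jet2 O →ₗ[ℝ] Jet1 O where
  toFun p := WithLp.toLp 2 (fun k => p (Sum.inl k))
  map_add' _ _ := rfl
  map_smul' _ _ := rfl

theorem partialDeriv_zero (i : Fin d) (x : EuclideanSpace ℝ (Fin d)) :
    partialDeriv i (fun _ => 0) x = 0 := by
  simp [partialDeriv]

theorem partialDeriv_add {O : Opens (EuclideanSpace ℝ (Fin d))} (i : Fin d) (φ ψ : 𝓓(O, ℝ))
    (x : EuclideanSpace ℝ (Fin d)) :
    partialDeriv i (φ + ψ : 𝓓(O, ℝ)) x = partialDeriv i φ x + partialDeriv i ψ x := by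
  have hφ : DifferentiableAt ℝ φ x := (φ.contDiff.differentiable (by simp)) x
  have hψ : DifferentiableAt ℝ ψ x := (ψ.contDiff.differentiable (by simp)) x
  have h : ((φ + ψ : 𝓓(O, ℝ)) : EuclideanSpace ℝ (Fin d) → ℝ) = fun y => φ y + ψ y := rfl
  simp only [partialDeriv, h]
  rw [fderiv_fun_add hφ hψ]
  rfl

theorem partialDeriv_smul {O : Opens (EuclideanSpace ℝ (Fin d))} (i : Fin d) (c : ℝ)
    (φ : 𝓓(O, ℝ)) (x : EuclideanSpace ℝ (Fin d)) :
    partialDeriv i (c • φ : 𝓓(O, ℝ)) x = c * partialDeriv i φ x := by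
  have hφ : DifferentiableAt ℝ φ x := (φ.contDiff.differentiable (by simp)) x
  have h : ((c • φ : 𝓓(O, ℝ)) : EuclideanSpace ℝ (Fin d) → ℝ) = fun y => c • φ y := rfl
  simp only [partialDeriv, h]
  rw [fderiv_fun_const_smul hφ]
  rfl

/-- The pairs `(φ, ∇φ)` with `φ ∈ C_c^∞(O)`. -/
def testJets (O : Opens (EuclideanSpace ℝ (Fin d))) : Submodule ℝ (Jet1 O) where
  carrier := {q | ∃ φ : 𝓓(O, ℝ),
    (q (Sum.inl ()) =ᵐ[volume.restrict (O : Set (EuclideanSpace ℝ (Fin d)))] φ) ∧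
    ∀ i, q (Sum.inr i) =ᵐ[volume.restrict (O : Set (EuclideanSpace ℝ (Fin d)))]
      partialDeriv i φ}
  zero_mem' := by
    refine ⟨0, ?_, fun i => ?_⟩
    · exact Lp.coeFn_zero ℝ 2 _
    · filter_upwards [Lp.coeFn_zero ℝ 2
        (volume.restrict (O : Set (EuclideanSpace ℝ (Fin d))))] with x hx
      exact hx.trans (partialDeriv_zero i x).symm
  add_mem' := by
    rintro p q ⟨φ, hφ, hφ'⟩ ⟨ψ, hψ, hψ'⟩
    refine ⟨φ + ψ, ?_, fun i => ?_⟩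
    · filter_upwards [Lp.coeFn_add (p (Sum.inl ())) (q (Sum.inl ())), hφ, hψ] with x hx h1 h2
      refine hx.trans ?_
      simp only [Pi.add_apply, h1, h2]
      rfl
    · filter_upwards [Lp.coeFn_add (p (Sum.inr i)) (q (Sum.inr i)), hφ' i, hψ' i] with x hx h1 h2
      refine hx.trans ?_
      rw [partialDeriv_add, Pi.add_apply, h1, h2]
  smul_mem' := by
    rintro c p ⟨φ, hφ, hφ'⟩
    refine ⟨c • φ, ?_, fun i => ?_⟩
    · filter_upwards [Lp.coeFn_smul c (p (Sum.inl ())), hφ] with x hx h1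
      refine hx.trans ?_
      simp only [Pi.smul_apply, h1]
      rfl
    · filter_upwards [Lp.coeFn_smul c (p (Sum.inr i)), hφ' i] with x hx h1
      refine hx.trans ?_
      rw [partialDeriv_smul, Pi.smul_apply, h1, smul_eq_mul]

/-- `H¹₀(O)`: the closure of `C_c^∞(O)` in the `H¹` norm, each `u` being represented by
`(u, ∇u)`. -/
def H10 (O : Opens (EuclideanSpace ℝ (Fin d))) : Submodule ℝ (Jet1 O) :=
  (testJets O).topologicalClosure

theorem integrable_mul_test {O : Opens (EuclideanSpace ℝ (Fin d))} (u : L2 O)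
    {φ : EuclideanSpace ℝ (Fin d) → ℝ} (hc : Continuous φ) (hs : HasCompactSupport φ) :
    Integrable (fun x => u x * φ x)
      (volume.restrict (O : Set (EuclideanSpace ℝ (Fin d)))) :=
  (Lp.memLp u).integrable_mul (q := 2) (hc.memLp_of_hasCompactSupport hs)

theorem continuous_partialDeriv {O : Opens (EuclideanSpace ℝ (Fin d))} (i : Fin d)
    (φ : 𝓓(O, ℝ)) : Continuous (partialDeriv i φ) :=
  (φ.contDiff.continuous_fderiv (by simp)).clm_apply continuous_const

theorem hasCompactSupport_partialDeriv {O : Opens (EuclideanSpace ℝ (Fin d))} (i : Fin d)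
    (φ : 𝓓(O, ℝ)) : HasCompactSupport (partialDeriv i φ) :=
  φ.hasCompactSupport.fderiv_apply ℝ (EuclideanSpace.single i 1)

theorem IsWeakPartial.zero {O : Opens (EuclideanSpace ℝ (Fin d))} (i : Fin d) :
    IsWeakPartial i (0 : L2 O) 0 := by
  intro φ
  have h0 := Lp.coeFn_zero ℝ 2 (volume.restrict (O : Set (EuclideanSpace ℝ (Fin d))))
  have h (ψ : EuclideanSpace ℝ (Fin d) → ℝ) :
      ∫ x in (O : Set (EuclideanSpace ℝ (Fin d))), (0 : L2 O) x * ψ x = 0 := by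
    refine integral_eq_zero_of_ae ?_
    filter_upwards [h0] with x hx
    rw [hx, Pi.zero_apply, zero_mul]
  rw [h, h, neg_zero]

theorem IsWeakPartial.add {O : Opens (EuclideanSpace ℝ (Fin d))} {i : Fin d}
    {u v u' v' : L2 O} (h : IsWeakPartial i u v) (h' : IsWeakPartial i u' v') :
    IsWeakPartial i (u + u') (v + v') := by
  intro φ
  have key (a b : L2 O) {ψ : EuclideanSpace ℝ (Fin d) → ℝ} (hc : Continuous ψ)
      (hs : HasCompactSupport ψ) :
      ∫ x in (O : Set (EuclideanSpace ℝ (Fin d))), (a + b) x * ψ x =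
        (∫ x in (O : Set (EuclideanSpace ℝ (Fin d))), a x * ψ x) +
          ∫ x in (O : Set (EuclideanSpace ℝ (Fin d))), b x * ψ x := by
    rw [← integral_add (integrable_mul_test a hc hs) (integrable_mul_test b hc hs)]
    refine integral_congr_ae ?_
    filter_upwards [Lp.coeFn_add a b] with x hx
    rw [hx, Pi.add_apply, add_mul]
  rw [key _ _ (continuous_partialDeriv i φ) (hasCompactSupport_partialDeriv i φ),
    key _ _ φ.continuous φ.hasCompactSupport, h φ, h' φ, neg_add]

theorem IsWeakPartial.smul {O : Opens (EuclideanSpace ℝ (Fin d))} {i : Fin d}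
    {u v : L2 O} (c : ℝ) (h : IsWeakPartial i u v) :
    IsWeakPartial i (c • u) (c • v) := by
  intro φ
  have key (a : L2 O) (ψ : EuclideanSpace ℝ (Fin d) → ℝ) :
      ∫ x in (O : Set (EuclideanSpace ℝ (Fin d))), (c • a) x * ψ x =
        c * ∫ x in (O : Set (EuclideanSpace ℝ (Fin d))), a x * ψ x := by
    rw [← integral_const_mul]
    refine integral_congr_ae ?_
    filter_upwards [Lp.coeFn_smul c a] with x hx
    rw [hx, Pi.smul_apply, smul_eq_mul, mul_assoc]
  rw [key, key, h φ, mul_neg]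

/-- A weak partial derivative is unique. -/
theorem IsWeakPartial.unique {O : Opens (EuclideanSpace ℝ (Fin d))} {i : Fin d}
    {u v w : L2 O} (h : IsWeakPartial i u v) (h' : IsWeakPartial i u w) : v = w := by
  have hloc : LocallyIntegrableOn (fun x => v x - w x)
      (O : Set (EuclideanSpace ℝ (Fin d))) volume := by
    have hv := (Lp.memLp v).sub (Lp.memLp w)
    exact locallyIntegrableOn_of_locallyIntegrable_restrict
      (hv.locallyIntegrable (by norm_num))
  have hz := O.isOpen.ae_eq_zero_of_integral_contDiff_smul_eq_zero hloc (by
    intro g hg hs ht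
    let φ : 𝓓(O, ℝ) := ⟨g, hg, hs, ht⟩
    have e : ∫ x in (O : Set (EuclideanSpace ℝ (Fin d))), v x * g x =
        ∫ x in (O : Set (EuclideanSpace ℝ (Fin d))), w x * g x :=
      neg_injective ((h φ).symm.trans (h' φ))
    rw [← setIntegral_eq_integral_of_forall_compl_eq_zero
      (s := (O : Set (EuclideanSpace ℝ (Fin d))))]
    · have : ∀ x, g x • (v x - w x) = v x * g x - w x * g x := fun x => by
        rw [smul_eq_mul]; ring
      simp only [this]
      rw [integral_sub (integrable_mul_test v hg.continuous hs)
        (integrable_mul_test w hg.continuous hs), e, sub_self]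
    · intro x hx
      have : g x = 0 := image_eq_zero_of_notMem_tsupport fun hx' => hx (ht hx')
      rw [this, zero_smul])
  refine Lp.ext ?_
  rw [Filter.EventuallyEq, ae_restrict_iff' O.isOpen.measurableSet]
  filter_upwards [hz] with x hx hxO
  exact sub_eq_zero.mp (hx hxO)

/-- `V = H¹₀(O) ∩ H²(O)`, each `u` being represented by `(u, ∇u, D²u)` (weak derivatives, which
`u` determines uniquely). As a subspace of `Jet2 O` it carries the `H²` norm. -/
def V (O : Opens (EuclideanSpace ℝ (Fin d))) : Submodule ℝ (Jet2 O) where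
  carrier := {p |
    (∀ i, IsWeakPartial i (p (Sum.inl (Sum.inl ()))) (p (Sum.inl (Sum.inr i)))) ∧
    (∀ i j, IsWeakPartial j (p (Sum.inl (Sum.inr i))) (p (Sum.inr (i, j)))) ∧
    Jet2.toJet1 O p ∈ H10 O}
  zero_mem' := ⟨fun i => .zero i, fun _ j => .zero j, by simp⟩
  add_mem' := by
    rintro p q ⟨h1, h2, h3⟩ ⟨k1, k2, k3⟩
    exact ⟨fun i => (h1 i).add (k1 i), fun i j => (h2 i j).add (k2 i j), by
      rw [map_add]; exact (H10 O).add_mem h3 k3⟩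
  smul_mem' := by
    rintro c p ⟨h1, h2, h3⟩
    exact ⟨fun i => (h1 i).smul c, fun i j => (h2 i j).smul c, by
      rw [map_smul]; exact (H10 O).smul_mem c h3⟩

namespace V

variable {O : Opens (EuclideanSpace ℝ (Fin d))}

/-- The element of `V` as a function in `L²(O)`. -/
def val (u : V O) : L2 O := u.1 (Sum.inl (Sum.inl ()))

/-- An element of `V` is determined by its underlying function. -/
theorem val_injective : Function.Injective (val : V O → L2 O) := by
  rintro ⟨p, hp1, hp2, hp3⟩ ⟨q, hq1, hq2, hq3⟩ h
  have h0 : p (Sum.inl (Sum.inl ())) = q (Sum.inl (Sum.inl ())) := h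
  have h1 (i : Fin d) : p (Sum.inl (Sum.inr i)) = q (Sum.inl (Sum.inr i)) :=
    (hp1 i).unique (h0 ▸ hq1 i)
  have h2 (i j : Fin d) : p (Sum.inr (i, j)) = q (Sum.inr (i, j)) :=
    (hp2 i j).unique (h1 i ▸ hq2 i j)
  refine Subtype.ext (PiLp.ext ?_)
  rintro ((⟨⟩ | i) | ⟨i, j⟩)
  exacts [h0, h1 i, h2 i j]

/-- The weak partial derivative `∂ᵢu`. -/
def grad (u : V O) (i : Fin d) : L2 O := u.1 (Sum.inl (Sum.inr i))

/-- The weak second derivative `∂ⱼ∂ᵢu`. -/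
def hess (u : V O) (i j : Fin d) : L2 O := u.1 (Sum.inr (i, j))

/-- The Laplacian `Δu = ∑ᵢ ∂ᵢ∂ᵢu`. -/
def lap (u : V O) : L2 O := ∑ i, hess u i i

/-- `‖u‖_{H¹₀} = ‖∇u‖_{L²}`. -/
def normH10 (u : V O) : ℝ := Real.sqrt (∑ i, ‖grad u i‖ ^ 2)

/-- `‖u‖_{H²₀} = ‖Δu‖_{L²}`. -/
def normH20 (u : V O) : ℝ := ‖lap u‖

/-- The energy norm `(‖u‖²_{L²} + 2‖∇u‖²_{L²} + ‖Δu‖²_{L²})^(1/2)` of `V`. -/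
def energyNorm (u : V O) : ℝ :=
  Real.sqrt (‖val u‖ ^ 2 + 2 * normH10 u ^ 2 + normH20 u ^ 2)

end V

/-- The odd power `x^(2n-1)` for a real exponent `n`, that is `|x|^(2n-2) x`. -/
def oddPow (n x : ℝ) : ℝ := |x| ^ (2 * n - 2) * x

/-- For an integer `n ≥ 1` this is the usual power. -/
theorem oddPow_natCast {n : ℕ} (hn : 1 ≤ n) (x : ℝ) : oddPow n x = x ^ (2 * n - 1) := by
  obtain ⟨k, rfl⟩ := Nat.exists_eq_add_of_le hn
  have h1 : (2 * ((1 + k : ℕ) : ℝ) - 2) = ((2 * k : ℕ) : ℝ) := by push_cast; ring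
  have h2 : 2 * (1 + k) - 1 = 2 * k + 1 := by omega
  rw [oddPow, h1, Real.rpow_natCast, h2, pow_succ, pow_mul, sq_abs, ← pow_mul]

/-- `‖u‖_{L^{2n}(O)}`; meaningful when `u ∈ L^{2n}(O)`. -/
def normL2n {O : Opens (EuclideanSpace ℝ (Fin d))} (n : ℝ) (u : L2 O) : ℝ :=
  (eLpNorm u (ENNReal.ofReal (2 * n))
    (volume.restrict (O : Set (EuclideanSpace ℝ (Fin d))))).toReal

/-- The function
`F(u) = ‖u‖²_{H²₀} u + 2‖u‖²_{H¹₀} u + ‖u‖^{2n}_{L^{2n}} u - u^{2n-1}` on `O`. -/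
def nonlinearity {O : Opens (EuclideanSpace ℝ (Fin d))} (n : ℝ) (u : V O)
    (x : EuclideanSpace ℝ (Fin d)) : ℝ :=
  V.normH20 u ^ 2 * V.val u x + 2 * V.normH10 u ^ 2 * V.val u x
    + normL2n n (V.val u) ^ (2 * n) * V.val u x - oddPow n (V.val u x)

/-- The explicit modulus `𝒢(r, s)` with parameters `C`, `Cₙ`, `n`. -/
def modulus (C Cn n r s : ℝ) : ℝ :=
  2 * C * (r ^ 2 + s ^ 2 + r * s)
    + Cn * ((2 * n - 1) / 2 * (r ^ (2 * n - 1) + s ^ (2 * n - 1)) * (r + s)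
      + (r ^ (2 * n) + s ^ (2 * n))
      + (1 + r ^ 2 + s ^ 2) ^ (1 / 3 : ℝ))

end SwiftHohenberg

end

open SwiftHohenberg

/-!
The nonlinearity is a sum of a scalar multiple of `u` and a pointwise power of `u`, so its Lipschitz
estimate is elementary once `‖u‖_{L^∞} ≤ K ‖Δu‖_{L²}` is known for `u ∈ V` (`V.exists_ae_abs_le`).
As the boundary of `O` is arbitrary, `H²` regularity up to the boundary and the Sobolev embedding of
`H²` are not available; the bound comes from Stampacchia's truncation method, which only needs `u`
to lie in `H¹₀(O)` and `Δu` in `L²(O)`.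

Let `H` be smooth with `H = 0` on `(-∞, k]`, `0 ≤ H ≤ 1`, `0 ≤ H' ≤ 2/δ`, and `H ≥ e⁻¹` on
`[k + δ, ∞)`. Testing `-Δu` with `H(u)` gives
`‖∇H(u)‖² ≤ (2/δ) ∫ H'(u) |∇u|² = -(2/δ) ∫ Δu H(u) ≤ (2/δ) ‖Δu‖ |{u > k}|^{1/2}`, and the Sobolev
inequality `‖·‖_{L⁶} ≤ S ‖∇·‖_{L²}`, valid for `d ≤ 3`, bounds `|{u > k + δ}|^{1/3}` by a multiple of
`‖Δu‖ |{u > k}|^{1/2} / δ` (`V.eLpNorm_comp_le`, `V.measure_superlevel_le`). Since `1/2 > 1/3`, the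
iteration lemma `eq_zero_of_superlinear_decay` shows that `|{u > k}| = 0` at a level `k` proportional
to `‖Δu‖`.

Given the bound, `norm_sub_le_modulus` estimates each term of the nonlinearity by the mean value
inequality for powers. It is stated for a general quantity `N` on `V` dominating the seminorms
involved, and is applied to the energy norm and to the full `H²` norm.
-/

open Filter Topology
open scoped NNReal ENNReal InnerProductSpace ContDiff

noncomputable section

namespace SwiftHohenberg

variable {d : ℕ} {O : Opens (EuclideanSpace ℝ (Fin d))}

/-! ### A smooth truncation profile -/

/-- A smooth bounded substitute for the truncation `x ↦ (x - k)⁺`: it takes values in `[0, 1]`,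
vanishes for `x ≤ k`, is at least `e⁻¹` for `x ≥ k + δ`, and its derivative lies in `[0, 2 / δ]`. -/
def cutoff (k δ x : ℝ) : ℝ := expNegInvGlue ((x - k) / δ)

theorem contDiff_cutoff (k δ : ℝ) : ContDiff ℝ ∞ (cutoff k δ) := by
  unfold cutoff
  exact expNegInvGlue.contDiff.comp (by fun_prop)

theorem cutoff_nonneg (k δ x : ℝ) : 0 ≤ cutoff k δ x := expNegInvGlue.nonneg _

theorem cutoff_le_one (k δ x : ℝ) : cutoff k δ x ≤ 1 := by
  unfold cutoff expNegInvGlue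
  split_ifs with h
  · exact zero_le_one
  · rw [Real.exp_le_one_iff, neg_nonpos]
    exact inv_nonneg.2 (not_le.1 h).le

theorem cutoff_of_le {k δ x : ℝ} (hδ : 0 < δ) (h : x ≤ k) : cutoff k δ x = 0 :=
  expNegInvGlue.zero_of_nonpos (div_nonpos_of_nonpos_of_nonneg (by linarith) hδ.le)

theorem le_cutoff {k δ x : ℝ} (hδ : 0 < δ) (h : k + δ ≤ x) : Real.exp (-1) ≤ cutoff k δ x := by
  have h1 : (1 : ℝ) ≤ (x - k) / δ := by rw [le_div_iff₀ hδ]; linarith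
  have h2 : expNegInvGlue 1 = Real.exp (-1) := by simp [expNegInvGlue, not_le.2 one_pos]
  exact h2 ▸ expNegInvGlue.monotone h1

theorem hasDerivAt_expNegInvGlue (x : ℝ) :
    HasDerivAt expNegInvGlue (x⁻¹ ^ 2 * expNegInvGlue x) x := by
  simpa using expNegInvGlue.hasDerivAt_polynomial_eval_inv_mul 1 x

theorem inv_sq_mul_expNegInvGlue_le (x : ℝ) : x⁻¹ ^ 2 * expNegInvGlue x ≤ 2 := by
  rcases le_or_gt x 0 with h | h
  · simp [expNegInvGlue.zero_of_nonpos h]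
  · have h1 : expNegInvGlue x = Real.exp (-x⁻¹) := by simp [expNegInvGlue, not_le.2 h]
    have h2 : 0 < x⁻¹ := inv_pos.2 h
    have h3 := Real.quadratic_le_exp_of_nonneg h2.le
    rw [h1, Real.exp_neg, ← div_eq_mul_inv, div_le_iff₀ (Real.exp_pos _)]
    linarith

theorem deriv_cutoff (k δ x : ℝ) :
    deriv (cutoff k δ) x =
      ((x - k) / δ)⁻¹ ^ 2 * expNegInvGlue ((x - k) / δ) * (1 / δ) := by
  have h : HasDerivAt (fun x : ℝ => (x - k) / δ) (1 / δ) x :=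
    ((hasDerivAt_id x).sub_const k).div_const δ
  exact ((hasDerivAt_expNegInvGlue _).comp x h).deriv

theorem deriv_cutoff_nonneg {k δ : ℝ} (hδ : 0 < δ) (x : ℝ) : 0 ≤ deriv (cutoff k δ) x := by
  rw [deriv_cutoff]
  have := expNegInvGlue.nonneg ((x - k) / δ)
  positivity

theorem deriv_cutoff_le {k δ : ℝ} (hδ : 0 < δ) (x : ℝ) : deriv (cutoff k δ) x ≤ 2 / δ := by
  rw [deriv_cutoff, div_eq_mul_one_div 2 δ]
  exact mul_le_mul_of_nonneg_right (inv_sq_mul_expNegInvGlue_le _) (by positivity)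

/-! ### Test functions as elements of `L²` and the Sobolev inequality -/

/-- A test function as an element of `L²(O)`. -/
def testL2 (φ : 𝓓(O, ℝ)) : L2 O :=
  (φ.continuous.memLp_of_hasCompactSupport φ.hasCompactSupport).toLp φ

/-- The gradient of a test function as a vector of elements of `L²(O)`. -/
def testGrad (φ : 𝓓(O, ℝ)) : PiLp 2 (fun _ : Fin d => L2 O) :=
  WithLp.toLp 2 fun i => ((continuous_partialDeriv i φ).memLp_of_hasCompactSupport
    (hasCompactSupport_partialDeriv i φ)).toLp (partialDeriv i φ)

theorem coeFn_testL2 (φ : 𝓓(O, ℝ)) :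
    testL2 φ =ᵐ[volume.restrict (O : Set (EuclideanSpace ℝ (Fin d)))] φ :=
  MemLp.coeFn_toLp _

theorem coeFn_testGrad (φ : 𝓓(O, ℝ)) (i : Fin d) :
    testGrad φ i =ᵐ[volume.restrict (O : Set (EuclideanSpace ℝ (Fin d)))] partialDeriv i φ :=
  MemLp.coeFn_toLp ((continuous_partialDeriv i φ).memLp_of_hasCompactSupport
    (hasCompactSupport_partialDeriv i φ))

/-- A linear functional on `ℝᵈ` is bounded by the sum of its values on the basis vectors. -/
theorem norm_fderiv_le_sum (φ : EuclideanSpace ℝ (Fin d) → ℝ) (x : EuclideanSpace ℝ (Fin d)) :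
    ‖fderiv ℝ φ x‖ ≤ ∑ i, ‖partialDeriv i φ x‖ := by
  refine ContinuousLinearMap.opNorm_le_bound _ (by positivity) fun v => ?_
  have hv : v = ∑ i, v i • EuclideanSpace.single i (1 : ℝ) := by
    ext j
    simp [Finset.sum_apply, Pi.single_apply]
  conv_lhs => rw [hv, map_sum]
  rw [Finset.sum_mul]
  refine (norm_sum_le _ _).trans (Finset.sum_le_sum fun i _ => ?_)
  rw [map_smul, norm_smul, mul_comm]
  exact mul_le_mul_of_nonneg_left (PiLp.norm_apply_le v i) (norm_nonneg _)

theorem eLpNorm_fderiv_le (φ : 𝓓(O, ℝ)) :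
    eLpNorm (fderiv ℝ φ) 2 (volume.restrict (O : Set (EuclideanSpace ℝ (Fin d)))) ≤
      ENNReal.ofReal (d * ‖testGrad φ‖) := by
  have h1 : eLpNorm (fderiv ℝ φ) 2 (volume.restrict (O : Set (EuclideanSpace ℝ (Fin d)))) ≤
      eLpNorm (∑ i, fun x => ‖partialDeriv i φ x‖) 2
        (volume.restrict (O : Set (EuclideanSpace ℝ (Fin d)))) := by
    refine eLpNorm_mono_real fun x => ?_
    rw [Finset.sum_apply]
    exact norm_fderiv_le_sum φ x
  have h2 (i : Fin d) : eLpNorm (fun x => ‖partialDeriv i φ x‖) 2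
      (volume.restrict (O : Set (EuclideanSpace ℝ (Fin d)))) ≤
      ENNReal.ofReal ‖testGrad φ‖ := by
    rw [eLpNorm_norm, ← eLpNorm_congr_ae (coeFn_testGrad φ i),
      ← Lp.enorm_def, ← ofReal_norm]
    exact ENNReal.ofReal_le_ofReal (PiLp.norm_apply_le _ i)
  refine h1.trans ((eLpNorm_sum_le (fun i _ =>
    (continuous_partialDeriv i φ).norm.aestronglyMeasurable) (by norm_num)).trans ?_)
  refine (Finset.sum_le_sum fun i _ => h2 i).trans ?_
  rw [Finset.sum_const, Finset.card_univ, Fintype.card_fin, nsmul_eq_mul,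
    ENNReal.ofReal_mul (by positivity), ENNReal.ofReal_natCast]

/-- The Sobolev inequality `‖φ‖_{L⁶} ≤ S ‖∇φ‖_{L²}` for test functions on a bounded open set in
dimension two or three. -/
theorem exists_sobolev_const (hd : d = 2 ∨ d = 3)
    (hO : Bornology.IsBounded (O : Set (EuclideanSpace ℝ (Fin d)))) :
    ∃ S : ℝ, 0 < S ∧ ∀ φ : 𝓓(O, ℝ),
      eLpNorm φ 6 (volume.restrict (O : Set (EuclideanSpace ℝ (Fin d)))) ≤
        ENNReal.ofReal (S * ‖testGrad φ‖) := by
  -- The exponent with Sobolev conjugate `6`; it is at most `2` as `d ≤ 3`.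
  obtain ⟨p, hp1, hp2, hpd, hp6⟩ : ∃ p : ℝ≥0, 1 ≤ p ∧ p ≤ 2 ∧ p < (d : ℝ≥0) ∧
      (p : ℝ)⁻¹ - (d : ℝ)⁻¹ ≤ (6 : ℝ)⁻¹ := by
    rcases hd with rfl | rfl
    · have h : (1 : ℝ≥0) ≤ 3 / 2 ∧ (3 / 2 : ℝ≥0) ≤ 2 ∧ (3 / 2 : ℝ≥0) < 2 := by
        refine ⟨?_, ?_, ?_⟩ <;> simp only [← NNReal.coe_le_coe, ← NNReal.coe_lt_coe] <;> norm_num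
      exact ⟨3 / 2, h.1, h.2.1, by exact_mod_cast h.2.2, by norm_num⟩
    · exact ⟨2, one_le_two, le_rfl, by norm_num, by norm_num⟩
  set μ := volume.restrict (O : Set (EuclideanSpace ℝ (Fin d)))
  have hfin : μ Set.univ ≠ ⊤ := by
    rw [Measure.restrict_apply_univ]; exact hO.measure_lt_top.ne
  set C : ℝ≥0 := eLpNormLESNormFDerivOfLeConst ℝ (volume : Measure (EuclideanSpace ℝ (Fin d)))
    (O : Set (EuclideanSpace ℝ (Fin d))) p 6
  set t : ℝ≥0∞ := μ Set.univ ^ (1 / (p : ℝ≥0∞).toReal - 1 / (2 : ℝ≥0∞).toReal)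
  have hp0 : (0 : ℝ) < p := lt_of_lt_of_le one_pos (by exact_mod_cast hp1)
  have ht : t ≠ ⊤ := by
    refine ENNReal.rpow_ne_top_of_nonneg ?_ hfin
    rw [sub_nonneg, ENNReal.coe_toReal, ENNReal.toReal_ofNat]
    exact one_div_le_one_div_of_le hp0 (by exact_mod_cast hp2)
  refine ⟨C * t.toReal * d + 1, by positivity, fun φ => ?_⟩
  have hsupp : Function.support φ ⊆ (O : Set (EuclideanSpace ℝ (Fin d))) :=
    (subset_tsupport _).trans φ.tsupport_subset
  have hsupp' : Function.support (fderiv ℝ φ) ⊆ (O : Set (EuclideanSpace ℝ (Fin d))) :=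
    (support_fderiv_subset ℝ).trans φ.tsupport_subset
  have hc : ContDiff ℝ 1 φ := φ.contDiff.of_le (by simp)
  have h1 : eLpNorm φ (6 : ℝ≥0) volume ≤ C * eLpNorm (fderiv ℝ φ) p volume :=
    eLpNorm_le_eLpNorm_fderiv_of_le volume hc hsupp hp1 (by simpa using hpd)
      (by simpa using hp6) hO
  rw [← eLpNorm_restrict_eq_of_support_subset hsupp,
    ← eLpNorm_restrict_eq_of_support_subset (f := fderiv ℝ φ) hsupp'] at h1
  have h2 : eLpNorm (fderiv ℝ φ) p μ ≤ eLpNorm (fderiv ℝ φ) 2 μ * t :=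
    eLpNorm_le_eLpNorm_mul_rpow_measure_univ (by exact_mod_cast hp2)
      (hc.continuous_fderiv one_ne_zero).aestronglyMeasurable
  calc eLpNorm φ 6 μ = eLpNorm φ (6 : ℝ≥0) μ := by norm_num
    _ ≤ C * (ENNReal.ofReal (d * ‖testGrad φ‖) * t) := by
      refine h1.trans ?_
      gcongr
      exact h2.trans (mul_le_mul_left (eLpNorm_fderiv_le φ) t)
    _ = ENNReal.ofReal (C * t.toReal * d * ‖testGrad φ‖) := by
      have e1 : (C : ℝ≥0∞) = ENNReal.ofReal C := (ENNReal.ofReal_coe_nnreal).symm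
      conv_lhs => rw [← ENNReal.ofReal_toReal ht, e1]
      rw [← ENNReal.ofReal_mul (by positivity), ← ENNReal.ofReal_mul (by positivity)]
      congr 1
      ring
    _ ≤ _ := by
      refine ENNReal.ofReal_le_ofReal ?_
      nlinarith [norm_nonneg (testGrad φ)]

/-! ### The energy inequality for truncations -/

/-- The composition `H ∘ φ` of a test function with a smooth `H` satisfying `H 0 = 0`. -/
def testComp {H : ℝ → ℝ} (hH : ContDiff ℝ ∞ H) (h0 : H 0 = 0) (φ : 𝓓(O, ℝ)) : 𝓓(O, ℝ) where
  toFun := H ∘ φ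
  contDiff' := hH.comp φ.contDiff
  hasCompactSupport' := φ.hasCompactSupport.comp_left h0
  tsupport_subset' := (tsupport_comp_subset h0 φ).trans φ.tsupport_subset

theorem testComp_apply {H : ℝ → ℝ} (hH : ContDiff ℝ ∞ H) (h0 : H 0 = 0) (φ : 𝓓(O, ℝ))
    (x : EuclideanSpace ℝ (Fin d)) : testComp hH h0 φ x = H (φ x) := rfl

theorem partialDeriv_testComp {H : ℝ → ℝ} (hH : ContDiff ℝ ∞ H) (h0 : H 0 = 0) (φ : 𝓓(O, ℝ))
    (i : Fin d) (x : EuclideanSpace ℝ (Fin d)) :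
    partialDeriv i (testComp hH h0 φ) x = deriv H (φ x) * partialDeriv i φ x := by
  have h1 : DifferentiableAt ℝ φ x := (φ.contDiff.differentiable (by simp)) x
  have h2 : DifferentiableAt ℝ H (φ x) := (hH.differentiable (by simp)) _
  have h3 : (testComp hH h0 φ : EuclideanSpace ℝ (Fin d) → ℝ) = fun y => H (φ y) := rfl
  have h4 : HasFDerivAt (fun y => H (φ y)) (deriv H (φ x) • fderiv ℝ φ x) x :=
    h2.hasDerivAt.comp_hasFDerivAt x h1.hasFDerivAt
  rw [partialDeriv, h3, h4.fderiv]
  rfl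

theorem lipschitzWith_of_deriv {H : ℝ → ℝ} (hH : ContDiff ℝ ∞ H) {Λ : ℝ≥0}
    (h1 : ∀ x, 0 ≤ deriv H x) (h2 : ∀ x, deriv H x ≤ Λ) : LipschitzWith Λ H :=
  lipschitzWith_of_nnnorm_deriv_le (hH.differentiable (by simp)) fun x => by
    rw [← NNReal.coe_le_coe, coe_nnnorm, Real.norm_of_nonneg (h1 x)]
    exact h2 x

theorem testL2_testComp {H : ℝ → ℝ} (hH : ContDiff ℝ ∞ H) (h0 : H 0 = 0) {Λ : ℝ≥0}
    (hL : LipschitzWith Λ H) (φ : 𝓓(O, ℝ)) :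
    testL2 (testComp hH h0 φ) = hL.compLp h0 (testL2 φ) := by
  refine Lp.ext ?_
  filter_upwards [coeFn_testL2 (testComp hH h0 φ), hL.coeFn_compLp h0 (testL2 φ),
    coeFn_testL2 φ] with x h1 h2 h3
  rw [h1, h2, Function.comp_apply, h3, testComp_apply]

/-- If `0 ≤ H' ≤ Λ` then `|∇H(φ)|² ≤ Λ ∇H(φ) · ∇φ`. -/
theorem norm_testGrad_testComp_sq_le {H : ℝ → ℝ} (hH : ContDiff ℝ ∞ H) (h0 : H 0 = 0) {Λ : ℝ≥0}
    (h1 : ∀ x, 0 ≤ deriv H x) (h2 : ∀ x, deriv H x ≤ Λ) (φ : 𝓓(O, ℝ)) :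
    ‖testGrad (testComp hH h0 φ)‖ ^ 2 ≤
      Λ * ⟪testGrad (testComp hH h0 φ), testGrad φ⟫_ℝ := by
  rw [← real_inner_self_eq_norm_sq, PiLp.inner_apply, PiLp.inner_apply, Finset.mul_sum]
  refine Finset.sum_le_sum fun i _ => ?_
  rw [L2.inner_def, L2.inner_def, ← integral_const_mul]
  refine integral_mono_ae (L2.integrable_inner _ _) ((L2.integrable_inner _ _).const_mul _) ?_
  filter_upwards [coeFn_testGrad (testComp hH h0 φ) i, coeFn_testGrad φ i] with x h3 h4
  simp only [h3, h4, partialDeriv_testComp, RCLike.inner_apply,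
    conj_trivial]
  have := mul_nonneg (mul_nonneg (h1 (φ x)) (sq_nonneg (partialDeriv i φ x)))
    (sub_nonneg.2 (h2 (φ x)))
  linarith

theorem norm_testGrad_testComp_le {H : ℝ → ℝ} (hH : ContDiff ℝ ∞ H) (h0 : H 0 = 0) {Λ : ℝ≥0}
    (h1 : ∀ x, 0 ≤ deriv H x) (h2 : ∀ x, deriv H x ≤ Λ) (φ : 𝓓(O, ℝ)) :
    ‖testGrad (testComp hH h0 φ)‖ ≤ Λ * ‖testGrad φ‖ := by
  have h3 := norm_testGrad_testComp_sq_le hH h0 h1 h2 φ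
  have h4 := real_inner_le_norm (testGrad (testComp hH h0 φ)) (testGrad φ)
  rcases (norm_nonneg (testGrad (testComp hH h0 φ))).eq_or_lt with h5 | h5
  · rw [← h5]; positivity
  · refine le_of_mul_le_mul_left ?_ h5
    nlinarith [mul_le_mul_of_nonneg_left h4 Λ.coe_nonneg]

/-- The weak gradient of `u ∈ V` as a vector of elements of `L²(O)`. -/
def V.gradVec (u : V O) : PiLp 2 (fun _ : Fin d => L2 O) := WithLp.toLp 2 (V.grad u)

theorem V.normH10_eq (u : V O) : V.normH10 u = ‖V.gradVec u‖ := by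
  rw [PiLp.norm_eq_of_L2]; rfl

/-- Green's formula `∫ ∇u · ∇ψ = -∫ Δu ψ` for a test function `ψ`. -/
theorem V.inner_gradVec_testGrad (u : V O) (ψ : 𝓓(O, ℝ)) :
    ⟪V.gradVec u, testGrad ψ⟫_ℝ = -⟪V.lap u, testL2 ψ⟫_ℝ := by
  rw [PiLp.inner_apply, V.lap, sum_inner, ← Finset.sum_neg_distrib]
  refine Finset.sum_congr rfl fun i _ => ?_
  have h : IsWeakPartial i (V.grad u i) (V.hess u i i) := u.2.2.1 i i
  rw [L2.inner_def, L2.inner_def]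
  refine Eq.trans (integral_congr_ae ?_) ((h ψ).trans (congrArg Neg.neg (integral_congr_ae ?_)))
  · filter_upwards [coeFn_testGrad ψ i] with x hx
    rw [hx, real_inner_comm]; rfl
  · filter_upwards [coeFn_testL2 ψ] with x hx
    rw [hx, real_inner_comm]; rfl

/-- Elements of `V` are limits of test functions in the `H¹` norm. -/
theorem V.exists_seq_test (u : V O) : ∃ φ : ℕ → 𝓓(O, ℝ),
    Tendsto (fun m => testL2 (φ m)) atTop (𝓝 (V.val u)) ∧
    Tendsto (fun m => testGrad (φ m)) atTop (𝓝 (V.gradVec u)) := by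
  obtain ⟨q, hq, hlim⟩ := mem_closure_iff_seq_limit.1 (show Jet2.toJet1 O u.1 ∈
    closure (testJets O : Set (Jet1 O)) from u.2.2.2)
  choose φ hφ hφ' using hq
  have hcoord (k : Unit ⊕ Fin d) :
      Tendsto (fun m => q m k) atTop (𝓝 (u.1 (Sum.inl k))) :=
    ((PiLp.continuous_apply 2 _ k).tendsto _).comp hlim
  refine ⟨φ, ?_, ?_⟩
  · convert hcoord (Sum.inl ()) using 2 with m
    · exact Lp.ext ((coeFn_testL2 _).trans (hφ m).symm)
    · rfl
  · refine ((PiLp.continuous_toLp 2 _).tendsto (V.grad u)).comp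
      (f := fun m i => testGrad (φ m) i) (tendsto_pi_nhds.2 fun i => ?_)
    convert hcoord (Sum.inr i) using 2 with m
    · exact Lp.ext ((coeFn_testGrad _ i).trans (hφ' m i).symm)
    · rfl

/-- The Sobolev norm of a truncation `H(u)` is controlled by testing `-Δu` against `H(u)`:
since `H'² ≤ Λ H'`, one has `‖∇H(u)‖² ≤ Λ ∫ H'(u) |∇u|² = -Λ ∫ Δu H(u)`. As `H(u)` need not be an
admissible test function, the estimate is derived for test functions approximating `u` and
passed to the limit by Fatou's lemma. -/
theorem V.eLpNorm_comp_le {S : ℝ} (hS : 0 < S)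
    (hsob : ∀ φ : 𝓓(O, ℝ), eLpNorm φ 6 (volume.restrict (O : Set (EuclideanSpace ℝ (Fin d)))) ≤
      ENNReal.ofReal (S * ‖testGrad φ‖))
    {H : ℝ → ℝ} (hH : ContDiff ℝ ∞ H) (h0 : H 0 = 0) {Λ : ℝ≥0}
    (h1 : ∀ x, 0 ≤ deriv H x) (h2 : ∀ x, deriv H x ≤ Λ) (u : V O) :
    eLpNorm (H ∘ V.val u) 6 (volume.restrict (O : Set (EuclideanSpace ℝ (Fin d)))) ≤
      ENNReal.ofReal (S * √(Λ * (‖V.lap u‖ *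
        ‖(lipschitzWith_of_deriv hH h1 h2).compLp h0 (V.val u)‖))) := by
  set hL := lipschitzWith_of_deriv hH h1 h2
  obtain ⟨φ, hφ, hφ'⟩ := V.exists_seq_test u
  set Q : ℕ → ℝ := fun m => Λ * (-⟪V.lap u, hL.compLp h0 (testL2 (φ m))⟫_ℝ +
    Λ * ‖testGrad (φ m)‖ * ‖testGrad (φ m) - V.gradVec u‖)
  have hcomp : Tendsto (fun m => hL.compLp h0 (testL2 (φ m))) atTop
      (𝓝 (hL.compLp h0 (V.val u))) := ((hL.continuous_compLp h0).tendsto _).comp hφ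
  have hQ : Tendsto Q atTop (𝓝 (Λ * (-⟪V.lap u, hL.compLp h0 (V.val u)⟫_ℝ))) := by
    have e1 : Tendsto (fun m => ⟪V.lap u, hL.compLp h0 (testL2 (φ m))⟫_ℝ) atTop
        (𝓝 ⟪V.lap u, hL.compLp h0 (V.val u)⟫_ℝ) := tendsto_const_nhds.inner hcomp
    have e2 : Tendsto (fun m => ‖testGrad (φ m) - V.gradVec u‖) atTop (𝓝 0) := by
      simpa using (hφ'.sub_const (V.gradVec u)).norm
    have e3 := ((hφ'.norm.const_mul (Λ : ℝ)).mul e2)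
    simpa using (e1.neg.add e3).const_mul (Λ : ℝ)
  have hgrad (m : ℕ) : ‖testGrad (testComp hH h0 (φ m))‖ ^ 2 ≤ Q m := by
    have e1 := norm_testGrad_testComp_sq_le hH h0 h1 h2 (φ m)
    have e2 := V.inner_gradVec_testGrad u (testComp hH h0 (φ m))
    rw [testL2_testComp hH h0 hL] at e2
    have e3 : ⟪testGrad (testComp hH h0 (φ m)), testGrad (φ m)⟫_ℝ =
        ⟪V.gradVec u, testGrad (testComp hH h0 (φ m))⟫_ℝ +
          ⟪testGrad (testComp hH h0 (φ m)), testGrad (φ m) - V.gradVec u⟫_ℝ := by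
      rw [inner_sub_right, real_inner_comm (V.gradVec u)]; ring
    refine e1.trans (mul_le_mul_of_nonneg_left ?_ Λ.coe_nonneg)
    rw [e3, e2]
    gcongr
    refine (real_inner_le_norm _ _).trans ?_
    gcongr
    exact norm_testGrad_testComp_le hH h0 h1 h2 _
  -- A subsequence converges almost everywhere.
  obtain ⟨ns, hns, hae⟩ := (tendstoInMeasure_of_tendsto_Lp hcomp).exists_seq_tendsto_ae
  have hlsc : eLpNorm (hL.compLp h0 (V.val u)) 6
      (volume.restrict (O : Set (EuclideanSpace ℝ (Fin d)))) ≤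
      liminf (fun m => eLpNorm (hL.compLp h0 (testL2 (φ (ns m)))) 6
        (volume.restrict (O : Set (EuclideanSpace ℝ (Fin d))))) atTop :=
    Lp.eLpNorm_lim_le_liminf_eLpNorm (fun m => Lp.aestronglyMeasurable _) _ hae
  rw [eLpNorm_congr_ae (hL.coeFn_compLp h0 (V.val u))] at hlsc
  have hterm (m : ℕ) : eLpNorm (hL.compLp h0 (testL2 (φ (ns m)))) 6
      (volume.restrict (O : Set (EuclideanSpace ℝ (Fin d)))) ≤
      ENNReal.ofReal (S * √(Q (ns m))) := by
    rw [← testL2_testComp hH h0 hL, eLpNorm_congr_ae (coeFn_testL2 _)]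
    refine (hsob _).trans (ENNReal.ofReal_le_ofReal ?_)
    exact mul_le_mul_of_nonneg_left (Real.le_sqrt_of_sq_le (hgrad _)) hS.le
  have hlim : Tendsto (fun m => ENNReal.ofReal (S * √(Q (ns m)))) atTop
      (𝓝 (ENNReal.ofReal (S * √(Λ * (-⟪V.lap u, hL.compLp h0 (V.val u)⟫_ℝ))))) :=
    (ENNReal.continuous_ofReal.tendsto _).comp
      (((Real.continuous_sqrt.tendsto _).comp (hQ.comp hns.tendsto_atTop)).const_mul S)
  refine hlsc.trans ((liminf_le_liminf (Eventually.of_forall hterm)).trans ?_)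
  rw [hlim.liminf_eq]
  gcongr
  exact (neg_le_abs _).trans (abs_real_inner_le_norm _ _)

/-! ### Boundedness of the elements of `V` -/

/-- Stampacchia's iteration lemma: an antitone nonnegative function whose decay from level `k` to
level `k + δ` is superlinear (with the natural scaling in `δ`) vanishes at a finite level. -/
theorem eq_zero_of_superlinear_decay {b : ℝ → ℝ} (hb : ∀ k, 0 ≤ b k) (hanti : Antitone b) {M D : ℝ}
    (hdecay : ∀ k δ, 0 ≤ k → 0 < δ → b (k + δ) ^ 2 ≤ M / δ * b k ^ 3)
    (hM : 0 ≤ M) (hD : 0 < D) (hMD : 8 * M * b 0 ≤ D) : b D = 0 := by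
  -- Geometric decay along the levels `D (1 - 2⁻ʲ)`.
  have key (j : ℕ) : b (D * (1 - (1 / 2) ^ j)) ≤ b 0 * (1 / 2) ^ j := by
    induction j with
    | zero => simp
    | succ j ih =>
      set t : ℝ := (1 / 2) ^ j with ht
      have htp : 0 < t := by positivity
      have ht1 : t ≤ 1 := pow_le_one₀ (by norm_num) (by norm_num)
      have e1 : D * (1 - (1 / 2) ^ (j + 1)) = D * (1 - t) + D * t / 2 := by
        rw [pow_succ, ← ht]; ring
      rw [e1, pow_succ, ← ht]
      refine le_of_sq_le_sq ?_ (by have := hb 0; positivity)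
      have h0 := hb 0
      calc b (D * (1 - t) + D * t / 2) ^ 2
          ≤ M / (D * t / 2) * b (D * (1 - t)) ^ 3 :=
            hdecay _ _ (mul_nonneg hD.le (by linarith)) (by positivity)
        _ ≤ M / (D * t / 2) * (b 0 * t) ^ 3 := by
            have := hb (D * (1 - t))
            gcongr
        _ = 8 * M * b 0 / D * (b 0 ^ 2 * t ^ 2 / 4) := by
            field_simp
            ring
        _ ≤ 1 * (b 0 ^ 2 * t ^ 2 / 4) := by
            gcongr
            exact (div_le_one hD).2 hMD
        _ = (b 0 * (t * (1 / 2))) ^ 2 := by ring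
  refine le_antisymm ?_ (hb D)
  have hlim : Tendsto (fun j : ℕ => b 0 * (1 / 2 : ℝ) ^ j) atTop (𝓝 0) := by
    simpa using (tendsto_pow_atTop_nhds_zero_of_lt_one (r := (1 / 2 : ℝ)) (by norm_num)
      (by norm_num)).const_mul (b 0)
  refine ge_of_tendsto' hlim fun j => (hanti ?_).trans (key j)
  have : (0 : ℝ) ≤ (1 / 2) ^ j := by positivity
  nlinarith

/-- The superlevel set `{u > k}`. -/
def V.superlevel (u : V O) (k : ℝ) : Set (EuclideanSpace ℝ (Fin d)) := {x | k < V.val u x}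

theorem V.measurableSet_superlevel (u : V O) (k : ℝ) : MeasurableSet (V.superlevel u k) :=
  measurableSet_lt measurable_const (Lp.stronglyMeasurable _).measurable

/-- The level-set inequality behind the boundedness of `u`. Since `6 > 4`, the power of
`|{u > k}|` on the right is larger than the one on the left. -/
theorem V.measure_superlevel_le {S : ℝ} (hS : 0 < S)
    (hsob : ∀ φ : 𝓓(O, ℝ), eLpNorm φ 6 (volume.restrict (O : Set (EuclideanSpace ℝ (Fin d)))) ≤
      ENNReal.ofReal (S * ‖testGrad φ‖))
    (hO : Bornology.IsBounded (O : Set (EuclideanSpace ℝ (Fin d)))) (u : V O) {k δ : ℝ}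
    (hk : 0 ≤ k) (hδ : 0 < δ) :
    ((volume.restrict (O : Set (EuclideanSpace ℝ (Fin d)))).real (V.superlevel u (k + δ))
        ^ (1 / 6 : ℝ)) ^ 2 ≤
      (2 * S ^ 2 * Real.exp 2 * ‖V.lap u‖) / δ *
        ((volume.restrict (O : Set (EuclideanSpace ℝ (Fin d)))).real (V.superlevel u k)
          ^ (1 / 6 : ℝ)) ^ 3 := by
  set μ := volume.restrict (O : Set (EuclideanSpace ℝ (Fin d))) with hμ
  have : IsFiniteMeasure μ := ⟨by
    rw [hμ, Measure.restrict_apply_univ]; exact hO.measure_lt_top⟩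
  obtain ⟨Λ, hΛ⟩ : ∃ Λ : ℝ≥0, (Λ : ℝ) = 2 / δ := ⟨⟨2 / δ, by positivity⟩, rfl⟩
  have hderiv (x : ℝ) : deriv (cutoff k δ) x ≤ Λ := hΛ ▸ deriv_cutoff_le hδ x
  have hL := lipschitzWith_of_deriv (contDiff_cutoff k δ) (deriv_cutoff_nonneg hδ) hderiv
  have h0 : cutoff k δ 0 = 0 := cutoff_of_le hδ hk
  have hmain := V.eLpNorm_comp_le hS hsob (contDiff_cutoff k δ) h0
    (deriv_cutoff_nonneg hδ) hderiv u
  rw [hΛ] at hmain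
  have hlow : ENNReal.ofReal (Real.exp (-1) * μ.real (V.superlevel u (k + δ)) ^ (1 / 6 : ℝ)) ≤
      eLpNorm (cutoff k δ ∘ V.val u) 6 μ := by
    have e1 : eLpNorm ((V.superlevel u (k + δ)).indicator fun _ => Real.exp (-1)) 6 μ ≤
        eLpNorm (cutoff k δ ∘ V.val u) 6 μ := by
      refine eLpNorm_mono fun x => ?_
      by_cases hx : x ∈ V.superlevel u (k + δ)
      · rw [Set.indicator_of_mem hx, Real.norm_of_nonneg (Real.exp_pos _).le,
          Function.comp_apply, Real.norm_of_nonneg (cutoff_nonneg _ _ _)]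
        exact le_cutoff hδ (le_of_lt hx)
      · rw [Set.indicator_of_notMem hx, norm_zero]
        exact norm_nonneg _
    refine le_trans (le_of_eq ?_) e1
    rw [eLpNorm_indicator_const (V.measurableSet_superlevel u _) (by norm_num) (by norm_num),
      ENNReal.ofReal_mul (Real.exp_pos _).le,
      ← ENNReal.ofReal_rpow_of_nonneg measureReal_nonneg (by norm_num), ofReal_measureReal,
      Real.enorm_of_nonneg (Real.exp_pos _).le]
    simp
  have hup : ‖hL.compLp h0 (V.val u)‖ ≤ μ.real (V.superlevel u k) ^ (1 / 2 : ℝ) := by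
    have e1 : eLpNorm (cutoff k δ ∘ V.val u) 2 μ ≤
        eLpNorm ((V.superlevel u k).indicator fun _ => (1 : ℝ)) 2 μ := by
      refine eLpNorm_mono fun x => ?_
      by_cases hx : x ∈ V.superlevel u k
      · rw [Set.indicator_of_mem hx, norm_one, Function.comp_apply,
          Real.norm_of_nonneg (cutoff_nonneg _ _ _)]
        exact cutoff_le_one _ _ _
      · rw [Set.indicator_of_notMem hx, norm_zero, Function.comp_apply,
          cutoff_of_le hδ (not_lt.1 hx), norm_zero]
    rw [eLpNorm_indicator_const (V.measurableSet_superlevel u _) (by norm_num) (by norm_num)] at e1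
    rw [Lp.norm_def, eLpNorm_congr_ae (hL.coeFn_compLp h0 (V.val u))]
    refine ENNReal.toReal_le_of_le_ofReal (by positivity) (e1.trans (le_of_eq ?_))
    rw [← ENNReal.ofReal_rpow_of_nonneg measureReal_nonneg (by norm_num), ofReal_measureReal]
    simp
  set a := μ.real (V.superlevel u (k + δ)) ^ (1 / 6 : ℝ) with ha
  set c := μ.real (V.superlevel u k) ^ (1 / 6 : ℝ) with hc
  have ha0 : 0 ≤ a := by positivity
  have hc3 : μ.real (V.superlevel u k) ^ (1 / 2 : ℝ) = c ^ 3 := by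
    rw [hc, ← Real.rpow_natCast, ← Real.rpow_mul measureReal_nonneg]; norm_num
  rw [hc3] at hup
  have hfin := (ENNReal.ofReal_le_ofReal_iff (by positivity)).1 (hlow.trans hmain)
  have hsq := pow_le_pow_left₀ (by positivity) hfin 2
  rw [mul_pow, mul_pow, Real.sq_sqrt (by positivity), ← Real.exp_nat_mul] at hsq
  have hexp : Real.exp (((2 : ℕ) : ℝ) * -1) * Real.exp 2 = 1 := by
    rw [← Real.exp_add]; norm_num
  calc a ^ 2 = Real.exp 2 * (Real.exp (((2 : ℕ) : ℝ) * -1) * a ^ 2) := by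
        linear_combination -(a ^ 2) * hexp
    _ ≤ Real.exp 2 * (S ^ 2 * (2 / δ * (‖V.lap u‖ * c ^ 3))) := by
        refine mul_le_mul_of_nonneg_left (hsq.trans ?_) (Real.exp_pos _).le
        refine mul_le_mul_of_nonneg_left ?_ (by positivity)
        exact mul_le_mul_of_nonneg_left (mul_le_mul_of_nonneg_left hup (norm_nonneg _))
          (by positivity)
    _ = _ := by ring

/-- Stampacchia's estimate `u ≤ K ‖Δu‖_{L²}`. No regularity of the boundary of `O` is used. -/
theorem V.exists_ae_le (hd : d = 2 ∨ d = 3)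
    (hO : Bornology.IsBounded (O : Set (EuclideanSpace ℝ (Fin d)))) :
    ∃ K : ℝ, 0 < K ∧ ∀ u : V O,
      ∀ᵐ x ∂(volume.restrict (O : Set (EuclideanSpace ℝ (Fin d)))),
        V.val u x ≤ K * V.normH20 u := by
  obtain ⟨S, hS, hsob⟩ := exists_sobolev_const hd hO
  set μ := volume.restrict (O : Set (EuclideanSpace ℝ (Fin d))) with hμ
  have : IsFiniteMeasure μ := ⟨by
    rw [hμ, Measure.restrict_apply_univ]; exact hO.measure_lt_top⟩
  refine ⟨8 * (2 * S ^ 2 * Real.exp 2) * μ.real Set.univ ^ (1 / 6 : ℝ) + 1, by positivity,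
    fun u => ?_⟩
  set K := 8 * (2 * S ^ 2 * Real.exp 2) * μ.real Set.univ ^ (1 / 6 : ℝ) + 1 with hK
  have hf : 0 ≤ V.normH20 u := norm_nonneg _
  have key (D : ℝ) (hD : 0 < D) (hKD : K * V.normH20 u ≤ D) : ∀ᵐ x ∂μ, V.val u x ≤ D := by
    have h := eq_zero_of_superlinear_decay
      (b := fun k => μ.real (V.superlevel u k) ^ (1 / 6 : ℝ))
      (M := 2 * S ^ 2 * Real.exp 2 * ‖V.lap u‖) (D := D) (fun k => by positivity)
      (fun k l hkl => by
        refine Real.rpow_le_rpow measureReal_nonneg ?_ (by norm_num)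
        exact measureReal_mono fun x hx => lt_of_le_of_lt hkl hx)
      (fun k δ hk hδ => V.measure_superlevel_le hS hsob hO u hk hδ) (by positivity) hD
      (by
        refine le_trans ?_ hKD
        have h1 : μ.real (V.superlevel u 0) ^ (1 / 6 : ℝ) ≤ μ.real Set.univ ^ (1 / 6 : ℝ) :=
          Real.rpow_le_rpow measureReal_nonneg (measureReal_mono (Set.subset_univ _))
            (by norm_num)
        have h2 : 8 * (2 * S ^ 2 * Real.exp 2 * ‖V.lap u‖) *
            μ.real (V.superlevel u 0) ^ (1 / 6 : ℝ) ≤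
            8 * (2 * S ^ 2 * Real.exp 2 * ‖V.lap u‖) * μ.real Set.univ ^ (1 / 6 : ℝ) := by
          gcongr
        refine h2.trans ?_
        rw [hK, V.normH20]
        linarith [norm_nonneg (V.lap u)])
    have h3 := (Real.rpow_eq_zero measureReal_nonneg (by norm_num)).1 h
    rw [measureReal_eq_zero_iff] at h3
    rw [ae_iff]
    simpa [V.superlevel, not_le] using h3
  -- The level `K ‖Δu‖` may be zero, so it is approached from above.
  have hall : ∀ᵐ x ∂μ, ∀ m : ℕ, V.val u x ≤ K * V.normH20 u + 1 / ((m : ℝ) + 1) :=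
    ae_all_iff.2 fun m => key _ (by positivity)
      (by linarith [Nat.one_div_pos_of_nat (α := ℝ) (n := m)])
  filter_upwards [hall] with x hx
  refine ge_of_tendsto' (f := fun m : ℕ => K * V.normH20 u + 1 / ((m : ℝ) + 1)) (x := atTop) ?_ hx
  simpa using tendsto_one_div_add_atTop_nhds_zero_nat.const_add (K * V.normH20 u)

/-! ### Elementary inequalities for powers -/

theorem abs_rpow_sub_rpow_le {p m x y : ℝ} (hp : 1 ≤ p) (hx : 0 ≤ x) (hy : 0 ≤ y) (hxm : x ≤ m)
    (hym : y ≤ m) : |x ^ p - y ^ p| ≤ p * m ^ (p - 1) * |x - y| := by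
  wlog h : y ≤ x generalizing x y
  · rw [abs_sub_comm, abs_sub_comm x]
    exact this hy hx hym hxm (le_of_not_ge h)
  rw [abs_of_nonneg (sub_nonneg.2 h),
    abs_of_nonneg (sub_nonneg.2 (Real.rpow_le_rpow hy h (by linarith)))]
  rcases hx.eq_or_lt with rfl | hx0
  · have : y = 0 := le_antisymm h hy
    simp [this]
  -- Bernoulli's inequality for `y / x`.
  have h1 : 1 + p * (y / x - 1) ≤ (y / x) ^ p := by
    have := one_add_mul_self_le_rpow_one_add (s := y / x - 1) (by linarith [div_nonneg hy hx]) hp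
    simpa using this
  rw [Real.div_rpow hy hx, le_div_iff₀ (Real.rpow_pos_of_pos hx0 p)] at h1
  have h2 : x ^ p = x ^ (p - 1) * x := by
    rw [Real.rpow_sub_one hx0.ne']; field_simp
  have h3 : (1 + p * (y / x - 1)) * x ^ p = x ^ p - p * x ^ (p - 1) * (x - y) := by
    rw [h2]; field_simp; ring
  have h4 : p * x ^ (p - 1) * (x - y) ≤ p * m ^ (p - 1) * (x - y) := by
    have := Real.rpow_le_rpow hx hxm (show 0 ≤ p - 1 by linarith)
    have := sub_nonneg.2 h
    gcongr
  linarith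

theorem oddPow_of_nonneg {n x : ℝ} (hn : 1 ≤ n) (hx : 0 ≤ x) : oddPow n x = x ^ (2 * n - 1) := by
  rw [oddPow, abs_of_nonneg hx]
  rcases hx.eq_or_lt with rfl | hx
  · rw [mul_zero, Real.zero_rpow (by linarith)]
  · rw [← Real.rpow_add_one hx.ne']; congr 1; ring

theorem oddPow_neg (n x : ℝ) : oddPow n (-x) = -oddPow n x := by simp [oddPow]

theorem abs_oddPow_le {n m x : ℝ} (hn : 1 ≤ n) (hx : |x| ≤ m) :
    |oddPow n x| ≤ m ^ (2 * n - 2) * |x| := by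
  rw [oddPow, abs_mul, abs_of_nonneg (Real.rpow_nonneg (abs_nonneg x) _)]
  exact mul_le_mul_of_nonneg_right
    (Real.rpow_le_rpow (abs_nonneg x) hx (by linarith)) (abs_nonneg x)

theorem abs_oddPow_sub_le {n m x y : ℝ} (hn : 1 ≤ n) (hx : |x| ≤ m) (hy : |y| ≤ m) :
    |oddPow n x - oddPow n y| ≤ (2 * n - 1) * m ^ (2 * n - 2) * |x - y| := by
  have hm : 0 ≤ m := (abs_nonneg x).trans hx
  have hsame {x y : ℝ} (hx : |x| ≤ m) (hy : |y| ≤ m) (hx0 : 0 ≤ x) (hy0 : 0 ≤ y) :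
      |oddPow n x - oddPow n y| ≤ (2 * n - 1) * m ^ (2 * n - 2) * |x - y| := by
    rw [oddPow_of_nonneg hn hx0, oddPow_of_nonneg hn hy0]
    have := abs_rpow_sub_rpow_le (p := 2 * n - 1) (by linarith) hx0 hy0
      ((le_abs_self x).trans hx) ((le_abs_self y).trans hy)
    rwa [show 2 * n - 1 - 1 = 2 * n - 2 by ring] at this
  have hopp {x y : ℝ} (hx : |x| ≤ m) (hy : |y| ≤ m) (hxy : |x| + |y| = |x - y|) :
      |oddPow n x - oddPow n y| ≤ (2 * n - 1) * m ^ (2 * n - 2) * |x - y| := by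
    have h1 := abs_oddPow_le hn hx
    have h2 := abs_oddPow_le hn hy
    have h3 := abs_sub (oddPow n x) (oddPow n y)
    have h4 : 0 ≤ m ^ (2 * n - 2) * |x - y| :=
      mul_nonneg (Real.rpow_nonneg hm _) (abs_nonneg _)
    rw [← hxy] at h4 ⊢
    nlinarith
  rcases le_total 0 x with hx0 | hx0 <;> rcases le_total 0 y with hy0 | hy0
  · exact hsame hx hy hx0 hy0
  · refine hopp hx hy ?_
    rw [abs_of_nonneg hx0, abs_of_nonpos hy0, abs_of_nonneg (by linarith)]; ring
  · refine hopp hx hy ?_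
    rw [abs_of_nonpos hx0, abs_of_nonneg hy0, abs_of_nonpos (by linarith)]; ring
  · have h := hsame (x := -x) (y := -y) (by rwa [abs_neg]) (by rwa [abs_neg])
      (by linarith) (by linarith)
    rw [oddPow_neg, oddPow_neg] at h
    rwa [show -oddPow n x - -oddPow n y = -(oddPow n x - oddPow n y) by ring, abs_neg,
      show -x - -y = -(x - y) by ring, abs_neg] at h

theorem measurable_oddPow (n : ℝ) : Measurable (oddPow n) :=
  (measurable_abs.pow_const _).mul measurable_id

/-! ### The terms of the nonlinearity on bounded functions -/

theorem memLp_of_ae_abs_le [IsFiniteMeasure (volume.restrict (O : Set (EuclideanSpace ℝ (Fin d))))]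
    {v : L2 O} {B : ℝ}
    (hv : ∀ᵐ x ∂(volume.restrict (O : Set (EuclideanSpace ℝ (Fin d)))), |v x| ≤ B) (p : ℝ≥0∞) :
    MemLp v p (volume.restrict (O : Set (EuclideanSpace ℝ (Fin d)))) :=
  MemLp.of_bound (Lp.aestronglyMeasurable v) B hv

theorem memLp_oddPow_of_ae_abs_le
    [IsFiniteMeasure (volume.restrict (O : Set (EuclideanSpace ℝ (Fin d))))]
    {n : ℝ} (hn : 1 ≤ n) {v : L2 O} {B : ℝ}
    (hv : ∀ᵐ x ∂(volume.restrict (O : Set (EuclideanSpace ℝ (Fin d)))), |v x| ≤ B) (p : ℝ≥0∞) :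
    MemLp (fun x => oddPow n (v x)) p (volume.restrict (O : Set (EuclideanSpace ℝ (Fin d)))) := by
  refine MemLp.of_bound ((measurable_oddPow n).comp_aemeasurable
    (Lp.aestronglyMeasurable v).aemeasurable).aestronglyMeasurable (B ^ (2 * n - 2) * B) ?_
  filter_upwards [hv] with x hx
  exact (abs_oddPow_le hn hx).trans (mul_le_mul_of_nonneg_left hx
    (Real.rpow_nonneg ((abs_nonneg _).trans hx) _))

theorem normL2n_rpow {n : ℝ} (hn : 1 ≤ n) {v : L2 O}
    (hv : MemLp v (ENNReal.ofReal (2 * n)) (volume.restrict (O : Set (EuclideanSpace ℝ (Fin d))))) :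
    normL2n n v ^ (2 * n) = ∫ x in (O : Set (EuclideanSpace ℝ (Fin d))), |v x| ^ (2 * n) := by
  have h0 : (0 : ℝ) < 2 * n := by linarith
  have hint : 0 ≤ ∫ x in (O : Set (EuclideanSpace ℝ (Fin d))), ‖v x‖ ^ (2 * n) :=
    integral_nonneg fun x => by positivity
  rw [normL2n, hv.eLpNorm_eq_integral_rpow_norm (by simpa using h0) ENNReal.ofReal_ne_top,
    ENNReal.toReal_ofReal h0.le, ENNReal.toReal_ofReal (by positivity), ← Real.rpow_mul hint,
    inv_mul_cancel₀ h0.ne', Real.rpow_one]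
  rfl

theorem integrable_abs_rpow {n : ℝ} (hn : 1 ≤ n) {v : L2 O}
    (hv : MemLp v (ENNReal.ofReal (2 * n)) (volume.restrict (O : Set (EuclideanSpace ℝ (Fin d))))) :
    Integrable (fun x => |v x| ^ (2 * n))
      (volume.restrict (O : Set (EuclideanSpace ℝ (Fin d)))) := by
  have h0 : (0 : ℝ) < 2 * n := by linarith
  have := hv.integrable_norm_rpow (by simpa using h0) ENNReal.ofReal_ne_top
  rwa [ENNReal.toReal_ofReal h0.le] at this

theorem normL2n_rpow_le [IsFiniteMeasure (volume.restrict (O : Set (EuclideanSpace ℝ (Fin d))))]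
    {n : ℝ} (hn : 1 ≤ n) {v : L2 O} {B : ℝ}
    (hv : ∀ᵐ x ∂(volume.restrict (O : Set (EuclideanSpace ℝ (Fin d)))), |v x| ≤ B) :
    normL2n n v ^ (2 * n) ≤
      B ^ (2 * n) * (volume.restrict (O : Set (EuclideanSpace ℝ (Fin d)))).real Set.univ := by
  have hm := memLp_of_ae_abs_le hv (ENNReal.ofReal (2 * n))
  rw [normL2n_rpow hn hm]
  refine (integral_mono_ae (g := fun _ => B ^ (2 * n)) (integrable_abs_rpow hn hm)
    (integrable_const _) ?_).trans (le_of_eq ?_)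
  · filter_upwards [hv] with x hx
    exact Real.rpow_le_rpow (abs_nonneg _) hx (by linarith)
  · rw [integral_const, smul_eq_mul, mul_comm]

theorem abs_normL2n_rpow_sub_le
    [IsFiniteMeasure (volume.restrict (O : Set (EuclideanSpace ℝ (Fin d))))]
    {n : ℝ} (hn : 1 ≤ n) {v w : L2 O} {B D : ℝ}
    (hv : ∀ᵐ x ∂(volume.restrict (O : Set (EuclideanSpace ℝ (Fin d)))), |v x| ≤ B)
    (hw : ∀ᵐ x ∂(volume.restrict (O : Set (EuclideanSpace ℝ (Fin d)))), |w x| ≤ B)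
    (hvw : ∀ᵐ x ∂(volume.restrict (O : Set (EuclideanSpace ℝ (Fin d)))), |(v - w) x| ≤ D) :
    |normL2n n v ^ (2 * n) - normL2n n w ^ (2 * n)| ≤
      2 * n * B ^ (2 * n - 1) * D *
        (volume.restrict (O : Set (EuclideanSpace ℝ (Fin d)))).real Set.univ := by
  have hmv := memLp_of_ae_abs_le hv (ENNReal.ofReal (2 * n))
  have hmw := memLp_of_ae_abs_le hw (ENNReal.ofReal (2 * n))
  rw [normL2n_rpow hn hmv, normL2n_rpow hn hmw,
    ← integral_sub (integrable_abs_rpow hn hmv) (integrable_abs_rpow hn hmw)]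
  refine norm_integral_le_of_norm_le_const (f := fun x => |v x| ^ (2 * n) - |w x| ^ (2 * n)) ?_
  filter_upwards [hv, hw, hvw, Lp.coeFn_sub v w] with x h1 h2 h3 h4
  rw [h4, Pi.sub_apply] at h3
  have hB : 0 ≤ B ^ (2 * n - 1) := Real.rpow_nonneg ((abs_nonneg _).trans h1) _
  refine (abs_rpow_sub_rpow_le (by linarith) (abs_nonneg _) (abs_nonneg _) h1 h2).trans ?_
  exact mul_le_mul_of_nonneg_left ((abs_abs_sub_abs_le _ _).trans h3) (by positivity)

/-! ### The Lipschitz estimate -/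

theorem V.val_sub (u v : V O) : V.val (u - v) = V.val u - V.val v := rfl

theorem V.lap_sub (u v : V O) : V.lap (u - v) = V.lap u - V.lap v := by
  simp only [V.lap, ← Finset.sum_sub_distrib]; rfl

theorem V.abs_normH20_sub_le (u v : V O) : |V.normH20 u - V.normH20 v| ≤ V.normH20 (u - v) := by
  rw [V.normH20, V.normH20, V.normH20, V.lap_sub]
  exact abs_norm_sub_norm_le _ _

theorem V.abs_normH10_sub_le (u v : V O) : |V.normH10 u - V.normH10 v| ≤ V.normH10 (u - v) := by
  rw [V.normH10_eq, V.normH10_eq, V.normH10_eq]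
  exact abs_norm_sub_norm_le _ _

/-- The scalar factor multiplying `u` in the nonlinearity. -/
def coupling (n : ℝ) (u : V O) : ℝ :=
  V.normH20 u ^ 2 + 2 * V.normH10 u ^ 2 + normL2n n (V.val u) ^ (2 * n)

theorem rpow_le_one_add_rpow {m a b : ℝ} (hm : 0 ≤ m) (ha : 0 ≤ a) (hab : a ≤ b) :
    m ^ a ≤ 1 + m ^ b := by
  rcases le_total m 1 with h | h
  · linarith [Real.rpow_le_one hm h ha, Real.rpow_nonneg hm b]
  · linarith [Real.rpow_le_rpow_of_exponent_le h hab]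

/-- The bracket that multiplies `Cₙ` in the modulus is itself `modulus 0 1`. -/
theorem modulus_eq (C Cn n r s : ℝ) : modulus C Cn n r s =
    2 * C * (r ^ 2 + s ^ 2 + r * s) + Cn * modulus 0 1 n r s := by
  simp [modulus]

/-- The three contributions of the power terms are dominated by the bracket of the modulus. -/
theorem powers_le_bracket {n r s : ℝ} (hn : 1 ≤ n) (hr : 0 ≤ r) (hs : 0 ≤ s) :
    r ^ (2 * n) ≤ modulus 0 1 n r s ∧ max r s ^ (2 * n - 1) * s ≤ 2 * modulus 0 1 n r s ∧
      max r s ^ (2 * n - 2) ≤ modulus 0 1 n r s := by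
  have hr1 := Real.rpow_nonneg hr (2 * n - 1)
  have hs1 := Real.rpow_nonneg hs (2 * n - 1)
  have hr2 := Real.rpow_nonneg hr (2 * n)
  have hs2 := Real.rpow_nonneg hs (2 * n)
  have h1 : (1 : ℝ) ≤ (1 + r ^ 2 + s ^ 2) ^ (1 / 3 : ℝ) :=
    Real.one_le_rpow (by nlinarith) (by norm_num)
  have hmax (a : ℝ) : max r s ^ a ≤ r ^ a + s ^ a := by
    have := Real.rpow_nonneg hr a
    have := Real.rpow_nonneg hs a
    rcases max_choice r s with h | h <;> rw [h] <;> linarith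
  have h2 : 0 ≤ (r ^ (2 * n - 1) + s ^ (2 * n - 1)) * (r + s) := by positivity
  have h3 : max r s ^ (2 * n - 1) * s ≤ (r ^ (2 * n - 1) + s ^ (2 * n - 1)) * (r + s) :=
    mul_le_mul (hmax _) (by linarith) hs (by positivity)
  have h4 : 1 / 2 * ((r ^ (2 * n - 1) + s ^ (2 * n - 1)) * (r + s)) ≤
      (2 * n - 1) / 2 * (r ^ (2 * n - 1) + s ^ (2 * n - 1)) * (r + s) := by
    rw [mul_assoc]
    exact mul_le_mul_of_nonneg_right (by linarith) h2
  have h5 := rpow_le_one_add_rpow (hr.trans (le_max_left r s)) (show 0 ≤ 2 * n - 2 by linarith)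
    (show 2 * n - 2 ≤ 2 * n by linarith)
  have h6 := hmax (2 * n)
  simp only [modulus]
  refine ⟨?_, ?_, ?_⟩ <;> linarith

/-- The Lipschitz estimate for the nonlinearity, in any norm-like quantity `N` on `V` that controls
`‖u‖_{L²}`, `‖∇u‖_{L²}`, `‖Δu‖_{L²}` and the supremum of `|u|`. -/
theorem norm_sub_le_modulus
    [IsFiniteMeasure (volume.restrict (O : Set (EuclideanSpace ℝ (Fin d))))]
    {n c K : ℝ} (hn : 1 ≤ n) (hK : 0 < K) {N : V O → ℝ}
    (hval : ∀ u, ‖V.val u‖ ≤ N u) (hlap : ∀ u, V.normH20 u ≤ c * N u)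
    (hgrad : ∀ u, √2 * V.normH10 u ≤ c * N u)
    (hsup : ∀ u, ∀ᵐ x ∂(volume.restrict (O : Set (EuclideanSpace ℝ (Fin d)))),
      |V.val u x| ≤ K * N u)
    {F : V O → L2 O} (hF : ∀ u : V O,
      F u =ᵐ[volume.restrict (O : Set (EuclideanSpace ℝ (Fin d)))] nonlinearity n u)
    (u₁ u₂ : V O) :
    ‖F u₁ - F u₂‖ ≤ modulus (c ^ 2)
      ((1 + 4 * n) * K ^ (2 * n) *
          (volume.restrict (O : Set (EuclideanSpace ℝ (Fin d)))).real Set.univ +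
        (2 * n - 1) * K ^ (2 * n - 2)) n (N u₁) (N u₂) * N (u₁ - u₂) := by
  set μ := volume.restrict (O : Set (EuclideanSpace ℝ (Fin d)))
  set r := N u₁ with hr
  set s := N u₂
  set w := N (u₁ - u₂)
  set m := max r s with hm
  set ν := μ.real Set.univ
  have hr0 : 0 ≤ r := (norm_nonneg _).trans (hval u₁)
  have hs0 : 0 ≤ s := (norm_nonneg _).trans (hval u₂)
  have hw0 : 0 ≤ w := (norm_nonneg _).trans (hval _)
  have hm0 : 0 ≤ m := hr0.trans (le_max_left _ _)
  have hν0 : 0 ≤ ν := measureReal_nonneg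
  have hb₁ : ∀ᵐ x ∂μ, |V.val u₁ x| ≤ K * m := (hsup u₁).mono fun x hx =>
    hx.trans (mul_le_mul_of_nonneg_left (le_max_left _ _) hK.le)
  have hb₂ : ∀ᵐ x ∂μ, |V.val u₂ x| ≤ K * m := (hsup u₂).mono fun x hx =>
    hx.trans (mul_le_mul_of_nonneg_left (le_max_right _ _) hK.le)
  -- Differences of squares of two of the norms.
  have hsq {a b t : ℝ} (ha : 0 ≤ a) (hb : 0 ≤ b) (har : a ≤ c * r) (hbs : b ≤ c * s)
      (ht : |a - b| ≤ t) (htw : t ≤ c * w) : |a ^ 2 - b ^ 2| ≤ c ^ 2 * (r + s) * w := by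
    rw [sq_sub_sq, abs_mul, abs_of_nonneg (add_nonneg ha hb)]
    calc (a + b) * |a - b| ≤ (c * r + c * s) * (c * w) :=
          mul_le_mul (add_le_add har hbs) (ht.trans htw) (abs_nonneg _) (by linarith)
      _ = _ := by ring
  have hA : |V.normH20 u₁ ^ 2 - V.normH20 u₂ ^ 2| ≤ c ^ 2 * (r + s) * w :=
    hsq (norm_nonneg _) (norm_nonneg _) (hlap u₁) (hlap u₂)
      (V.abs_normH20_sub_le u₁ u₂) (hlap (u₁ - u₂))
  have hB : |(√2 * V.normH10 u₁) ^ 2 - (√2 * V.normH10 u₂) ^ 2| ≤ c ^ 2 * (r + s) * w := by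
    refine hsq (mul_nonneg (Real.sqrt_nonneg _) (Real.sqrt_nonneg _))
      (mul_nonneg (Real.sqrt_nonneg _) (Real.sqrt_nonneg _)) (hgrad u₁) (hgrad u₂) ?_
      (hgrad (u₁ - u₂))
    rw [← mul_sub, abs_mul, abs_of_nonneg (Real.sqrt_nonneg _)]
    exact mul_le_mul_of_nonneg_left (V.abs_normH10_sub_le u₁ u₂) (Real.sqrt_nonneg _)
  have hL : |normL2n n (V.val u₁) ^ (2 * n) - normL2n n (V.val u₂) ^ (2 * n)| ≤
      2 * n * (K * m) ^ (2 * n - 1) * (K * w) * ν :=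
    abs_normL2n_rpow_sub_le hn hb₁ hb₂ (hsup (u₁ - u₂))
  have hA₁ : V.normH20 u₁ ^ 2 ≤ c ^ 2 * r ^ 2 := by
    rw [← mul_pow]; exact pow_le_pow_left₀ (norm_nonneg _) (hlap u₁) 2
  have hB₁ : (√2 * V.normH10 u₁) ^ 2 ≤ c ^ 2 * r ^ 2 := by
    rw [← mul_pow]
    exact pow_le_pow_left₀ (mul_nonneg (Real.sqrt_nonneg _) (Real.sqrt_nonneg _)) (hgrad u₁) 2
  have hL₁ := normL2n_rpow_le hn (hsup u₁)
  have hL₁0 : 0 ≤ normL2n n (V.val u₁) ^ (2 * n) := Real.rpow_nonneg ENNReal.toReal_nonneg _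
  simp only [mul_pow, Real.sq_sqrt zero_le_two] at hB hB₁
  have hc₁ : |coupling n u₁| ≤ 2 * c ^ 2 * r ^ 2 + K ^ (2 * n) * r ^ (2 * n) * ν := by
    rw [← hr, Real.mul_rpow hK.le hr0] at hL₁
    rw [coupling, abs_of_nonneg (by positivity)]
    linarith
  have hc₁₂ : |coupling n u₁ - coupling n u₂| ≤ 2 * c ^ 2 * (r + s) * w +
      2 * n * K ^ (2 * n) * m ^ (2 * n - 1) * w * ν := by
    have e : K ^ (2 * n) = K ^ (2 * n - 1) * K := by
      rw [← Real.rpow_add_one hK.ne']; congr 1; ring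
    rw [Real.mul_rpow hK.le hm0] at hL
    rw [abs_le] at hA hB hL ⊢
    rw [coupling, coupling, e]
    constructor <;> linarith [hA.1, hA.2, hB.1, hB.2, hL.1, hL.2]
  -- The pointwise power.
  set P : V O → L2 O := fun u => coupling n u • V.val u - F u with hP
  have hPae (u : V O) : P u =ᵐ[μ] fun x => oddPow n (V.val u x) := by
    filter_upwards [Lp.coeFn_sub (coupling n u • V.val u) (F u),
      Lp.coeFn_smul (coupling n u) (V.val u), hF u] with x h1 h2 h3
    rw [hP, h1, Pi.sub_apply, h2, h3, Pi.smul_apply, smul_eq_mul, nonlinearity, coupling]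
    ring
  have hPd : ‖P u₁ - P u₂‖ ≤ (2 * n - 1) * K ^ (2 * n - 2) * m ^ (2 * n - 2) * w := by
    have h1 : ‖P u₁ - P u₂‖ ≤
        (2 * n - 1) * (K * m) ^ (2 * n - 2) * ‖V.val u₁ - V.val u₂‖ := by
      refine Lp.norm_le_mul_norm_of_ae_le_mul ?_
      filter_upwards [Lp.coeFn_sub (P u₁) (P u₂), Lp.coeFn_sub (V.val u₁) (V.val u₂), hPae u₁,
        hPae u₂, hb₁, hb₂] with x h1 h2 h3 h4 h5 h6
      rw [h1, h2, Pi.sub_apply, Pi.sub_apply, h3, h4]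
      exact abs_oddPow_sub_le hn h5 h6
    rw [Real.mul_rpow hK.le hm0, ← V.val_sub, ← mul_assoc] at h1
    refine h1.trans (mul_le_mul_of_nonneg_left (hval _) ?_)
    have : 0 ≤ 2 * n - 1 := by linarith
    positivity
  have hsplit : F u₁ - F u₂ = coupling n u₁ • (V.val u₁ - V.val u₂) +
      (coupling n u₁ - coupling n u₂) • V.val u₂ - (P u₁ - P u₂) := by
    simp only [hP]; module
  have htri : ‖F u₁ - F u₂‖ ≤ |coupling n u₁| * w + |coupling n u₁ - coupling n u₂| * s +
      ‖P u₁ - P u₂‖ := by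
    rw [hsplit]
    refine (norm_sub_le _ _).trans (add_le_add_left ((norm_add_le _ _).trans ?_) _)
    rw [norm_smul, norm_smul, Real.norm_eq_abs, Real.norm_eq_abs, ← V.val_sub]
    exact add_le_add (mul_le_mul_of_nonneg_left (hval _) (abs_nonneg _))
      (mul_le_mul_of_nonneg_left (hval _) (abs_nonneg _))
  obtain ⟨p1, p2, p3⟩ := powers_le_bracket hn hr0 hs0
  rw [← hm] at p2 p3
  set G := modulus 0 1 n r s
  have hKn : 0 ≤ K ^ (2 * n) := by positivity
  have hKn' : 0 ≤ K ^ (2 * n - 2) := by positivity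
  calc ‖F u₁ - F u₂‖ ≤ (2 * c ^ 2 * r ^ 2 + K ^ (2 * n) * r ^ (2 * n) * ν) * w +
        (2 * c ^ 2 * (r + s) * w + 2 * n * K ^ (2 * n) * m ^ (2 * n - 1) * w * ν) * s +
        (2 * n - 1) * K ^ (2 * n - 2) * m ^ (2 * n - 2) * w := by
        refine htri.trans ?_
        gcongr
    _ = (2 * c ^ 2 * (r ^ 2 + s ^ 2 + r * s) + (K ^ (2 * n) * ν) * r ^ (2 * n) +
        (2 * n * K ^ (2 * n) * ν) * (m ^ (2 * n - 1) * s) +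
        ((2 * n - 1) * K ^ (2 * n - 2)) * m ^ (2 * n - 2)) * w := by ring
    _ ≤ (2 * c ^ 2 * (r ^ 2 + s ^ 2 + r * s) + (K ^ (2 * n) * ν) * G +
        (2 * n * K ^ (2 * n) * ν) * (2 * G) + ((2 * n - 1) * K ^ (2 * n - 2)) * G) * w := by
        have : 0 ≤ 2 * n - 1 := by linarith
        gcongr
    _ = _ := by rw [modulus_eq]; ring

/-! ### The two norms on `V` -/

theorem V.norm_sq_eq (u : V O) :
    ‖u‖ ^ 2 = ‖V.val u‖ ^ 2 + V.normH10 u ^ 2 + ∑ i, ∑ j, ‖V.hess u i j‖ ^ 2 := by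
  rw [V.normH10, Real.sq_sqrt (by positivity), ← Fintype.sum_prod_type',
    show ‖u‖ = ‖u.1‖ from rfl, PiLp.norm_sq_eq_of_L2, Fintype.sum_sum_type, Fintype.sum_sum_type]
  simp only [Finset.univ_unique, Finset.sum_singleton]
  rfl

theorem V.normH20_sq_le (u : V O) : V.normH20 u ^ 2 ≤ d * ‖u‖ ^ 2 := by
  have h1 : V.normH20 u ≤ ∑ i, ‖V.hess u i i‖ := norm_sum_le _ _
  have h2 := (pow_le_pow_left₀ (norm_nonneg _) h1 2).trans (sq_sum_le_card_mul_sum_sq)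
  rw [Finset.card_univ, Fintype.card_fin] at h2
  refine h2.trans (mul_le_mul_of_nonneg_left ?_ (Nat.cast_nonneg d))
  have h3 : ∑ i, ‖V.hess u i i‖ ^ 2 ≤ ∑ i, ∑ j, ‖V.hess u i j‖ ^ 2 :=
    Finset.sum_le_sum fun i _ =>
      Finset.single_le_sum (f := fun j => ‖V.hess u i j‖ ^ 2) (fun j _ => by positivity)
        (Finset.mem_univ i)
  rw [V.norm_sq_eq]
  nlinarith [sq_nonneg ‖V.val u‖, sq_nonneg (V.normH10 u)]

theorem V.energyNorm_sq (u : V O) :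
    V.energyNorm u ^ 2 = ‖V.val u‖ ^ 2 + 2 * V.normH10 u ^ 2 + V.normH20 u ^ 2 :=
  Real.sq_sqrt (by positivity)

/-- Stampacchia's estimate applied to `u` and to `-u`: `‖u‖_{L^∞} ≤ K ‖Δu‖_{L²}`. -/
theorem V.exists_ae_abs_le (hd : d = 2 ∨ d = 3)
    (hO : Bornology.IsBounded (O : Set (EuclideanSpace ℝ (Fin d)))) :
    ∃ K : ℝ, 0 < K ∧ ∀ u : V O,
      ∀ᵐ x ∂(volume.restrict (O : Set (EuclideanSpace ℝ (Fin d)))),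
        |V.val u x| ≤ K * V.normH20 u := by
  obtain ⟨K, hK, h⟩ := V.exists_ae_le hd hO
  refine ⟨K, hK, fun u => ?_⟩
  have hneg : V.normH20 (-u) = V.normH20 u := by
    have := V.lap_sub 0 u
    rw [zero_sub, show V.lap (0 : V O) = 0 from Finset.sum_eq_zero fun _ _ => rfl, zero_sub] at this
    rw [V.normH20, V.normH20, this, norm_neg]
  filter_upwards [h u, h (-u), Lp.coeFn_neg (V.val u)] with x h1 h2 h3
  rw [hneg, show V.val (-u) = -V.val u from rfl, h3, Pi.neg_apply] at h2
  exact abs_le.2 ⟨by linarith, h1⟩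

theorem modulus_le_modulus {C Cn n r s R : ℝ} (hC : 0 ≤ C) (hCn : 0 ≤ Cn) (hn : 1 ≤ n)
    (hr : 0 ≤ r) (hs : 0 ≤ s) (hrR : r ≤ R) (hsR : s ≤ R) :
    modulus C Cn n r s ≤ modulus C Cn n R R := by
  have hR := hr.trans hrR
  have h1 : 0 ≤ 2 * n - 1 := by linarith
  have h2 : 0 ≤ 2 * n := by linarith
  have e1 := Real.rpow_le_rpow hr hrR h1
  have e2 := Real.rpow_le_rpow hs hsR h1
  have e3 := Real.rpow_le_rpow hr hrR h2
  have e4 := Real.rpow_le_rpow hs hsR h2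
  have e5 := Real.rpow_nonneg hr (2 * n - 1)
  unfold modulus
  gcongr

theorem locallyLipschitz_of_modulus {C Cn n : ℝ} (hC : 0 ≤ C) (hCn : 0 ≤ Cn) (hn : 1 ≤ n)
    {F : V O → L2 O}
    (hF : ∀ u₁ u₂ : V O, ‖F u₁ - F u₂‖ ≤ modulus C Cn n ‖u₁‖ ‖u₂‖ * ‖u₁ - u₂‖) :
    LocallyLipschitz F := by
  intro u
  refine ⟨(modulus C Cn n (‖u‖ + 1) (‖u‖ + 1)).toNNReal, Metric.ball u 1,
    Metric.ball_mem_nhds u one_pos, LipschitzOnWith.of_dist_le_mul fun v hv w hw => ?_⟩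
  have hb {v : V O} (hv : v ∈ Metric.ball u 1) : ‖v‖ ≤ ‖u‖ + 1 := by
    have h1 := norm_sub_norm_le v u
    have h2 : ‖v - u‖ < 1 := by rwa [Metric.mem_ball, dist_eq_norm] at hv
    linarith
  rw [dist_eq_norm, dist_eq_norm]
  refine (hF v w).trans (mul_le_mul_of_nonneg_right ?_ (norm_nonneg _))
  exact (modulus_le_modulus hC hCn hn (norm_nonneg _) (norm_nonneg _) (hb hv) (hb hw)).trans
    (Real.le_coe_toNNReal _)

end SwiftHohenberg

end

theorem lemma4p1 {d : ℕ} (hd : d = 2 ∨ d = 3)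
    (O : Opens (EuclideanSpace ℝ (Fin d)))
    (hO : Bornology.IsBounded (O : Set (EuclideanSpace ℝ (Fin d)))) :
    ∃ C : ℝ, 0 < C ∧ ∀ n : ℝ, 1 ≤ n → ∃ Cn : ℝ, 0 < Cn ∧
      ∃ F : V O → L2 O,
        (∀ u : V O,
          MemLp (V.val u) (ENNReal.ofReal (2 * n))
            (volume.restrict (O : Set (EuclideanSpace ℝ (Fin d))))) ∧
        (∀ u : V O,
          F u =ᵐ[volume.restrict (O : Set (EuclideanSpace ℝ (Fin d)))]
            nonlinearity n u) ∧
        LocallyLipschitz F ∧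
        (∀ u₁ u₂ : V O,
          ‖F u₁ - F u₂‖ ≤
            modulus C Cn n (V.energyNorm u₁) (V.energyNorm u₂)
              * V.energyNorm (u₁ - u₂)) ∧
        (∀ u₁ u₂ : V O,
          ‖F u₁ - F u₂‖ ≤
            modulus C Cn n ‖u₁‖ ‖u₂‖ * ‖u₁ - u₂‖) := by
  obtain ⟨K, hK, hsup⟩ := V.exists_ae_abs_le hd hO
  have : IsFiniteMeasure (volume.restrict (O : Set (EuclideanSpace ℝ (Fin d)))) := ⟨by
    rw [Measure.restrict_apply_univ]; exact hO.measure_lt_top⟩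
  have hd3 : (d : ℝ) ≤ 4 := by rcases hd with rfl | rfl <;> norm_num
  -- The factor `2 ≥ √d` accounts for `‖Δu‖ ≤ √d ‖D²u‖`.
  refine ⟨2 ^ 2, by norm_num, fun n hn => ?_⟩
  have h2n : 0 < 2 * n - 1 := by linarith
  have hCn : 0 < (1 + 4 * n) * (K * 2) ^ (2 * n) *
      (volume.restrict (O : Set (EuclideanSpace ℝ (Fin d)))).real Set.univ +
        (2 * n - 1) * (K * 2) ^ (2 * n - 2) := by positivity
  have hF (u : V O) : (coupling n u • V.val u -
      (memLp_oddPow_of_ae_abs_le hn (hsup u) 2).toLp _ : L2 O)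
      =ᵐ[volume.restrict (O : Set (EuclideanSpace ℝ (Fin d)))] nonlinearity n u := by
    filter_upwards [Lp.coeFn_sub (coupling n u • V.val u)
      ((memLp_oddPow_of_ae_abs_le hn (hsup u) 2).toLp _),
      Lp.coeFn_smul (coupling n u) (V.val u),
      (memLp_oddPow_of_ae_abs_le hn (hsup u) 2).coeFn_toLp] with x h1 h2 h3
    rw [h1, Pi.sub_apply, h2, h3, Pi.smul_apply, smul_eq_mul, nonlinearity, coupling]
    ring
  have hsupN {N : V O → ℝ} (hN : ∀ u, V.normH20 u ≤ 2 * N u) (u : V O) :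
      ∀ᵐ x ∂(volume.restrict (O : Set (EuclideanSpace ℝ (Fin d)))),
        |V.val u x| ≤ K * 2 * N u := (hsup u).mono fun x hx => by
    refine hx.trans ?_
    rw [mul_assoc]
    exact mul_le_mul_of_nonneg_left (hN u) hK.le
  have hs2 : √2 ^ 2 = (2 : ℝ) := Real.sq_sqrt zero_le_two
  have hE (u₁ u₂ : V O) := by
    have h20 (u : V O) : V.normH20 u ≤ 2 * V.energyNorm u := by
      refine le_of_sq_le_sq ?_ (mul_nonneg zero_le_two (Real.sqrt_nonneg _))
      rw [mul_pow, V.energyNorm_sq]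
      nlinarith [sq_nonneg ‖V.val u‖, sq_nonneg (V.normH10 u), sq_nonneg (V.normH20 u)]
    refine norm_sub_le_modulus hn (mul_pos hK two_pos) (N := V.energyNorm) (c := 2) (fun u => ?_)
      h20 (fun u => ?_) (hsupN h20) hF u₁ u₂
    · refine Real.le_sqrt_of_sq_le ?_
      nlinarith [sq_nonneg (V.normH10 u), sq_nonneg (V.normH20 u)]
    · refine le_of_sq_le_sq ?_ (mul_nonneg zero_le_two (Real.sqrt_nonneg _))
      rw [mul_pow, mul_pow, hs2, V.energyNorm_sq]
      nlinarith [sq_nonneg ‖V.val u‖, sq_nonneg (V.normH10 u), sq_nonneg (V.normH20 u)]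
  have hH (u₁ u₂ : V O) := by
    have h20 (u : V O) : V.normH20 u ≤ 2 * ‖u‖ := by
      refine le_of_sq_le_sq ?_ (by positivity)
      rw [mul_pow]
      refine (V.normH20_sq_le u).trans ?_
      nlinarith [sq_nonneg ‖u‖]
    have hhess (u : V O) : 0 ≤ ∑ i, ∑ j, ‖V.hess u i j‖ ^ 2 := by positivity
    refine norm_sub_le_modulus hn (mul_pos hK two_pos) (N := fun u => ‖u‖) (c := 2) (fun u => ?_)
      h20 (fun u => ?_) (hsupN h20) hF u₁ u₂
    · refine le_of_sq_le_sq ?_ (norm_nonneg _)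
      rw [V.norm_sq_eq]
      nlinarith [sq_nonneg (V.normH10 u), hhess u]
    · refine le_of_sq_le_sq ?_ (by positivity)
      rw [mul_pow, mul_pow, hs2, V.norm_sq_eq]
      nlinarith [sq_nonneg ‖V.val u‖, sq_nonneg (V.normH10 u), hhess u]
  exact ⟨_, hCn, _, fun u => memLp_of_ae_abs_le (hsup u) _, hF,
    locallyLipschitz_of_modulus (by norm_num) hCn.le hn hH, hE, hH⟩
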